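/- Let $n\ge 2$, let $\omega\subset\mathbb R^{n-1}$ be a nonempty bounded open set (for example a bounded connected Lipschitz domain), and put $\Omega_\ell=(-\ell,\ell)\times\omega$ for $\ell>0$; points are written $x=(x_1,x')$ with $x_1\in(-\ell,\ell)$, $x'\in\omega$, $\nabla'$ is the gradient in $x'$, and $\|\cdot\|_{2,D}$ is the norm of $L^2(D)$. Set $$\lambda_1:=\inf_{v\in H^1_0(\omega)\setminus\{0\}}\frac{\|\nabla' v\|_{2,\omega}}{\|v\|_{2,\omega}}$$ (the square root of the first Dirichlet eigenvalue of $-\Delta'$ on $\omega$). For $f\in L^2(\omega)$ let $u_\infty\in H^1_0(\omega)$ be the weak solution of $-\Delta' u_\infty=f$ in $\omega$, and let $u_\ell\in H^1_0(\Omega_\ell)$ be the weak solution of $-\Delta u_\ell=1\otimes f$ in $\Omega_\ell$, where $(g\otimes h)(x)=g(x_1)h(x')$. Let $\psi_\ell(a,x_1)=1-\cosh(ax_1)/\cosh(a\ell)$ and $\lambda_\infty=\|\nabla' u_\infty\|_{2,\omega}/\|u_\infty\|_{2,\omega}$ (if $u_\infty=0$, then $\psi_\ell(\lambda_\infty,\cdot)\otimes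 u_\infty$ is understood to be $0$). Then $\lambda_1>0$, and for all $0\le\delta_\ell<\ell$ the function $u_\ell-\psi_\ell(\lambda_\infty,\cdot)\otimes u_\infty$ belongs to $H^1(\Omega_\ell)$ and $$\left\|\nabla\left(u_\ell-\psi_\ell(\lambda_\infty,\cdot)\otimes u_\infty\right)\right\|_{2,\Omega_{\ell-\delta_\ell}}^2\le C^{(1)}\|u_\infty\|_{2,\omega}^2+C^{(2)}\|\nabla' u_\infty\|_{2,\omega}^2,$$ $$C^{(1)}=4e^{-2\lambda_1\delta_\ell},\qquad C^{(2)}=4\left(\frac1{\lambda_1}e^{-2\lambda_1\delta_\ell}+6(\ell-\delta_\ell)e^{-2\lambda_1\ell}\right).$$ Moreover, there are constants $c,\tilde c>0$ depending only on $\omega$ such that, for all $f$ and all $0\le\delta_\ell<\ell$, the right-hand side of this estimate is at most $c\,e^{-\tilde c\,\delta_\ell}\left(\|u_\infty\|_{2,\omega}^2+\|\nabla' u_\infty\|_{2,\omega}^2\right)$. In particular, if $\varepsilon>0$ and $\varepsilon\ell\le\delta_\ell<\ell$ for all sufficiently large $\ell$, then the right-hand side is $O(e^{-\tilde c\,\varepsilon\,\ell})$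 and tends to $0$ as $\ell\to\infty$. -/

import Mathlib

open MeasureTheory Filter Topology Asymptotics


namespace LongDomain

noncomputable section

/-- The Euclidean space `ℝ^m`. -/
abbrev E (m : ℕ) : Type := EuclideanSpace ℝ (Fin m)

/-- `φ ∈ C_c^∞(Ω)`. -/
def IsTestFunction {m : ℕ} (Ω : Set (E m)) (φ : E m → ℝ) : Prop :=
  ContDiff ℝ ((⊤ : ℕ∞) : WithTop ℕ∞) φ ∧ HasCompactSupport φ ∧ tsupport φ ⊆ Ω

/-- `g` is a weak (distributional) gradient of `u` on the open set `Ω`. -/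
def IsWeakGrad {m : ℕ} (Ω : Set (E m)) (u : E m → ℝ) (g : E m → E m) : Prop :=
  LocallyIntegrableOn u Ω ∧ LocallyIntegrableOn g Ω ∧
    ∀ φ : E m → ℝ, IsTestFunction Ω φ →
      ∫ x in Ω, u x • gradient φ x = - ∫ x in Ω, φ x • g x

open Classical in
/-- The weak gradient of `u` on `Ω`; it is unique up to a null set when it exists.
It is only used for functions that have one. -/
def weakGrad {m : ℕ} (Ω : Set (E m)) (u : E m → ℝ) : E m → E m :=
  if h : ∃ g, IsWeakGrad Ω u g then h.choose else 0

/-- `u ∈ H¹(Ω)`. -/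
def MemH1 {m : ℕ} (Ω : Set (E m)) (u : E m → ℝ) : Prop :=
  MemLp u 2 (volume.restrict Ω) ∧
    ∃ g : E m → E m, IsWeakGrad Ω u g ∧ MemLp g 2 (volume.restrict Ω)

/-- `u ∈ H¹₀(Ω)`: the function `u` is in `H¹(Ω)` and is the limit, in the norm of `H¹(Ω)`, of a
sequence in `C_c^∞(Ω)`. -/
def MemH10 {m : ℕ} (Ω : Set (E m)) (u : E m → ℝ) : Prop :=
  MemH1 Ω u ∧ ∃ φ : ℕ → E m → ℝ, (∀ k, IsTestFunction Ω (φ k)) ∧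
    Tendsto (fun k => eLpNorm (fun x => u x - φ k x) 2 (volume.restrict Ω)) atTop (𝓝 0) ∧
    Tendsto (fun k => eLpNorm (fun x => weakGrad Ω u x - gradient (φ k) x) 2
      (volume.restrict Ω)) atTop (𝓝 0)

/-- The norm of `L²(Ω)`, for scalar functions and for vector fields. -/
def l2norm {m : ℕ} {V : Type} [NormedAddCommGroup V] (Ω : Set (E m)) (u : E m → V) : ℝ :=
  Real.sqrt (∫ x in Ω, ‖u x‖ ^ 2)

/-- `u ∈ H¹₀(Ω)` is the weak solution of `-Δ u = F` in `Ω`, `u = 0` on `∂Ω`. -/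
def IsWeakSolution {m : ℕ} (Ω : Set (E m)) (F u : E m → ℝ) : Prop :=
  MemH10 Ω u ∧ ∀ v : E m → ℝ, MemH10 Ω v →
    ∫ x in Ω, inner ℝ (weakGrad Ω u x) (weakGrad Ω v x) = ∫ x in Ω, F x * v x

/-- `λ₁`, the infimum of `‖∇v‖ / ‖v‖` over the `v ≠ 0` in `H¹₀(S)`. -/
def lambdaOne {d : ℕ} (S : Set (E d)) : ℝ :=
  sInf {r : ℝ | ∃ v : E d → ℝ, MemH10 S v ∧ l2norm S v ≠ 0 ∧
    r = l2norm S (weakGrad S v) / l2norm S v}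

/-- The cross-section variable `x' = (x₂, …, x_n)` of `x = (x₁, x')`. -/
def crossPart {d : ℕ} (x : E (d + 1)) : E d :=
  WithLp.toLp 2 (fun i : Fin d => x i.succ)

/-- The cylinder `Ω_ℓ = (-ℓ, ℓ) × S`. -/
def longDomain {d : ℕ} (S : Set (E d)) (ℓ : ℝ) : Set (E (d + 1)) :=
  {x | x 0 ∈ Set.Ioo (-ℓ) ℓ ∧ crossPart x ∈ S}

/-- `(g ⊗ h)(x) = g(x₁) h(x')`. -/
def tensor {d : ℕ} (g : ℝ → ℝ) (h : E d → ℝ) : E (d + 1) → ℝ :=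
  fun x => g (x 0) * h (crossPart x)

/-- `ψ_ℓ(a, t) = 1 - cosh (a t) / cosh (a ℓ)`. -/
def psi (ℓ a t : ℝ) : ℝ := 1 - Real.cosh (a * t) / Real.cosh (a * ℓ)

/-- `λ_∞ = ‖∇'u_∞‖ / ‖u_∞‖`; when `u_∞ = 0` its value is irrelevant, as it only enters through
`ψ_ℓ(λ_∞, ·) ⊗ u_∞`. -/
def lambdaInf {d : ℕ} (S : Set (E d)) (u : E d → ℝ) : ℝ :=
  l2norm S (weakGrad S u) / l2norm S u

/-- The error `u_ℓ - ψ_ℓ(λ_∞, ·) ⊗ u_∞` of the one-term approximation. -/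
def approxError {d : ℕ} (S : Set (E d)) (uinf : E d → ℝ) (ℓ : ℝ) (ul : E (d + 1) → ℝ) :
    E (d + 1) → ℝ :=
  fun x => ul x - tensor (psi ℓ (lambdaInf S uinf)) uinf x

/-- `C⁽¹⁾ = 4 e^{-2 λ₁ δ}`. -/
def C1 {d : ℕ} (S : Set (E d)) (δ : ℝ) : ℝ := 4 * Real.exp (-2 * lambdaOne S * δ)

/-- `C⁽²⁾ = 4 (λ₁⁻¹ e^{-2 λ₁ δ} + 6 (ℓ - δ) e^{-2 λ₁ ℓ})`. -/
def C2 {d : ℕ} (S : Set (E d)) (ℓ δ : ℝ) : ℝ :=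
  4 * (1 / lambdaOne S * Real.exp (-2 * lambdaOne S * δ) +
    6 * (ℓ - δ) * Real.exp (-2 * lambdaOne S * ℓ))

/-- The bound `C⁽¹⁾ ‖u_∞‖² + C⁽²⁾ ‖∇'u_∞‖²`. -/
def errorBound {d : ℕ} (S : Set (E d)) (uinf : E d → ℝ) (ℓ δ : ℝ) : ℝ :=
  C1 S δ * l2norm S uinf ^ 2 + C2 S ℓ δ * l2norm S (weakGrad S uinf) ^ 2

end

end LongDomain

open LongDomain

/-! Write `U` for the class of u_∞ and `G` for ∇u_ℓ. If u_∞ were a finite sum ∑ aᵢ bᵢ of Dirichlet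
eigenfunctions with eigenvalues mᵢ², then u_ℓ would be ∑ aᵢ ψ_ℓ(mᵢ, ·) ⊗ bᵢ, since ψ = ψ_ℓ(m, ·)
solves -ψ'' + m²ψ = m² with ψ(±ℓ) = 0. A Galerkin argument replaces the spectral decomposition, so
no compact embedding and no regularity of ∂ω is used.

The gradients of tensor products φ ⊗ x span a dense subspace of the gradients of H¹₀(Ω_ℓ)
(`integral_inner_gradient_eq_zero`, `mem_closure_tensorFields`). Hence `G` is within ε of some `y`
involving finitely many cross-section functions. On the span of these and `U`, the Dirichlet form is
diagonalised against the L² product: the bᵢ are orthonormal with orthogonal gradients, and mᵢ =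
‖∇'bᵢ‖ ≥ λ₁. With U = ∑ aᵢ bᵢ, the field T = ∑ aᵢ ∇(ψ_ℓ(mᵢ, ·) ⊗ bᵢ) satisfies the Galerkin
equations for this span, so ‖G - T‖ ≤ ‖G - y‖ ≤ ε (`exists_separated_approx`).

It remains to replace every mᵢ by λ_∞. By orthogonality the energy of the difference on Ω_{ℓ-δ} is a
sum over i. The functions 1 - ψ_ℓ(m, ·) are nonnegative and their derivatives share the sign of t,
so the square of a difference is at most the sum of the squares. Each cosh energy is at most 2r
e^{-2rδ} ≤ (2/λ₁) e^{-2λ₁δ} r² for r ≥ λ₁ (`integral_cosh_energy_le`). The choice λ_∞² ‖u_∞‖² =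
‖∇'u_∞‖² makes the λ_∞ parts add up to a cosh energy as well (`sum_energy_le`). The total, (4/λ₁)
e^{-2λ₁δ} ‖∇'u_∞‖², is independent of ε and of the bᵢ, and is already one of the terms of the
asserted bound. -/

namespace LongDomain

/-! ### Test functions, weak gradients, and H¹ and H¹₀ with an explicit gradient. -/

section

lemma tendsto_integral_inner {X F : Type*} [MeasurableSpace X] {μ : Measure X}
    [NormedAddCommGroup F] [InnerProductSpace ℝ F] {f h : X → F} {fk : ℕ → X → F}
    (hf : MemLp f 2 μ) (hfk : ∀ k, MemLp (fk k) 2 μ) (hh : MemLp h 2 μ)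
    (hlim : Tendsto (fun k => eLpNorm (fun x => f x - fk k x) 2 μ) atTop (𝓝 0)) :
    Tendsto (fun k => ∫ x, inner ℝ (fk k x) (h x) ∂μ) atTop (𝓝 (∫ x, inner ℝ (f x) (h x) ∂μ)) := by
  have key : ∀ {a b : X → F} (ha : MemLp a 2 μ) (hb : MemLp b 2 μ),
      inner ℝ (ha.toLp a) (hb.toLp b) = ∫ x, inner ℝ (a x) (b x) ∂μ := by
    intro a b ha hb
    rw [L2.inner_def]
    refine integral_congr_ae ?_
    filter_upwards [ha.coeFn_toLp, hb.coeFn_toLp] with x h1 h2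
    rw [h1, h2]
  have h1 : Tendsto (fun k => (hfk k).toLp (fk k)) atTop (𝓝 (hf.toLp f)) := by
    rw [Lp.tendsto_Lp_iff_tendsto_eLpNorm'']
    refine hlim.congr fun k => ?_
    exact eLpNorm_sub_comm f (fk k) 2 μ
  have h2 := h1.inner (tendsto_const_nhds (x := hh.toLp h)) (𝕜 := ℝ)
  simp only [key] at h2
  exact h2

lemma eLpNorm_tendsto_of_sub {X F : Type*} [MeasurableSpace X] {μ : Measure X}
    [NormedAddCommGroup F] [InnerProductSpace ℝ F] {f : X → F} {fk : ℕ → X → F}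
    (hf : MemLp f 2 μ) (hfk : ∀ k, MemLp (fk k) 2 μ)
    (hlim : Tendsto (fun k => eLpNorm (fun x => f x - fk k x) 2 μ) atTop (𝓝 0)) :
    Tendsto (fun k => (eLpNorm (fk k) 2 μ).toReal) atTop (𝓝 (eLpNorm f 2 μ).toReal) := by
  have h1 : Tendsto (fun k => (hfk k).toLp (fk k)) atTop (𝓝 (hf.toLp f)) := by
    rw [Lp.tendsto_Lp_iff_tendsto_eLpNorm'']
    refine hlim.congr fun k => ?_
    exact eLpNorm_sub_comm f (fk k) 2 μ
  simpa [Lp.norm_toLp] using h1.norm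

variable {m : ℕ} {Ω : Set (E m)}

lemma IsTestFunction.continuous {φ : E m → ℝ} (h : IsTestFunction Ω φ) : Continuous φ :=
  h.1.continuous

lemma IsTestFunction.differentiable {φ : E m → ℝ} (h : IsTestFunction Ω φ) : Differentiable ℝ φ :=
  h.1.differentiable (by simp)

lemma IsTestFunction.continuous_fderiv {φ : E m → ℝ} (h : IsTestFunction Ω φ) :
    Continuous (fderiv ℝ φ) :=
  h.1.continuous_fderiv (by simp)

lemma IsTestFunction.continuous_gradient {φ : E m → ℝ} (h : IsTestFunction Ω φ) :
    Continuous (gradient φ) :=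
  (InnerProductSpace.toDual ℝ (E m)).symm.continuous.comp h.continuous_fderiv

lemma IsTestFunction.hasCompactSupport_gradient {φ : E m → ℝ} (h : IsTestFunction Ω φ) :
    HasCompactSupport (gradient φ) := by
  have : gradient φ = (InnerProductSpace.toDual ℝ (E m)).symm ∘ fderiv ℝ φ := rfl
  rw [this]
  exact (h.2.1.fderiv (𝕜 := ℝ)).comp_left (map_zero _)

lemma IsTestFunction.memLp {φ : E m → ℝ} (h : IsTestFunction Ω φ) {p : ENNReal} :
    MemLp φ p (volume.restrict Ω) :=
  (h.continuous.memLp_of_hasCompactSupport h.2.1).restrict _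

lemma IsTestFunction.memLp_gradient {φ : E m → ℝ} (h : IsTestFunction Ω φ) {p : ENNReal} :
    MemLp (gradient φ) p (volume.restrict Ω) :=
  (h.continuous_gradient.memLp_of_hasCompactSupport h.hasCompactSupport_gradient).restrict _

lemma IsTestFunction.gradient_eq_zero {φ : E m → ℝ} (h : IsTestFunction Ω φ) {x : E m}
    (hx : x ∉ Ω) : gradient φ x = 0 := by
  have : fderiv ℝ φ x = 0 :=
    image_eq_zero_of_notMem_tsupport fun hx' => hx (h.2.2 (tsupport_fderiv_subset ℝ hx'))
  simp [gradient, this]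

lemma IsTestFunction.eq_zero {φ : E m → ℝ} (h : IsTestFunction Ω φ) {x : E m}
    (hx : x ∉ Ω) : φ x = 0 :=
  image_eq_zero_of_notMem_tsupport fun hx' => hx (h.2.2 hx')

/-- Integration by parts for test functions, in the direction `v`. -/
lemma IsTestFunction.integral_mul_inner_gradient {φ χ : E m → ℝ} (h : IsTestFunction Ω φ)
    (hχ : IsTestFunction Ω χ) (v : E m) :
    ∫ x in Ω, φ x * inner ℝ (gradient χ x) v = -∫ x in Ω, χ x * inner ℝ (gradient φ x) v := by
  rw [setIntegral_eq_integral_of_forall_compl_eq_zero (fun x hx => by simp [h.eq_zero hx]),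
    setIntegral_eq_integral_of_forall_compl_eq_zero (fun x hx => by simp [hχ.eq_zero hx])]
  simp only [inner_gradient_left]
  have hc : ∀ {a b : E m → ℝ}, IsTestFunction Ω a → IsTestFunction Ω b →
      Integrable (fun x => a x * fderiv ℝ b x v) volume := by
    intro a b ha hb
    refine Continuous.integrable_of_hasCompactSupport ?_ ?_
    · exact ha.continuous.mul (hb.continuous_fderiv.clm_apply continuous_const)
    · exact ha.2.1.mul_right
  rw [integral_mul_fderiv_eq_neg_fderiv_mul_of_integrable]
  · simp [mul_comm]
  · simpa [mul_comm] using hc hχ h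
  · exact hc h hχ
  · exact (h.continuous.mul hχ.continuous).integrable_of_hasCompactSupport h.2.1.mul_right
  · exact fun x _ => h.differentiable x
  · exact fun x _ => hχ.differentiable x

/-- Pairing with fixed directions turns the vector identity into scalar ones. Finite measure makes
L² functions integrable, which supplies the local integrability conditions. -/
lemma isWeakGrad_iff (hΩ : volume Ω ≠ ⊤) {u : E m → ℝ} {g : E m → E m}
    (hu : MemLp u 2 (volume.restrict Ω)) (hg : MemLp g 2 (volume.restrict Ω)) :
    IsWeakGrad Ω u g ↔ ∀ φ, IsTestFunction Ω φ → ∀ v : E m,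
      ∫ x in Ω, u x * inner ℝ (gradient φ x) v = - ∫ x in Ω, φ x * inner ℝ (g x) v := by
  have : IsFiniteMeasure (volume.restrict Ω) := ⟨by simpa using hΩ.lt_top⟩
  have hu1 : IntegrableOn u Ω := hu.integrable (by norm_num)
  have hg1 : IntegrableOn g Ω := hg.integrable (by norm_num)
  have key : ∀ φ, IsTestFunction Ω φ → ((∫ x in Ω, u x • gradient φ x = - ∫ x in Ω, φ x • g x) ↔
      ∀ v : E m,
      ∫ x in Ω, u x * inner ℝ (gradient φ x) v = - ∫ x in Ω, φ x * inner ℝ (g x) v) := by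
    intro φ hφ
    have i1 : Integrable (fun x => u x • gradient φ x) (volume.restrict Ω) :=
      memLp_one_iff_integrable.1 (hφ.memLp_gradient.smul hu (p := 2) (q := 2) (r := 1))
    have i2 : Integrable (fun x => φ x • g x) (volume.restrict Ω) :=
      memLp_one_iff_integrable.1 (hg.smul hφ.memLp (p := 2) (q := 2) (r := 1))
    have e1 : ∀ v, ∫ x in Ω, u x * inner ℝ (gradient φ x) v =
        inner ℝ v (∫ x in Ω, u x • gradient φ x) := by
      intro v
      rw [← integral_inner i1]
      simp [inner_smul_right]
    have e2 : ∀ v, ∫ x in Ω, φ x * inner ℝ (g x) v =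
        inner ℝ v (∫ x in Ω, φ x • g x) := by
      intro v
      rw [← integral_inner i2]
      simp [inner_smul_right, real_inner_comm]
    simp only [e1, e2, ← inner_neg_right]
    exact ⟨fun h v => by rw [h], fun h => ext_inner_left ℝ h⟩
  constructor
  · rintro ⟨-, -, h⟩ φ hφ
    exact (key φ hφ).1 (h φ hφ)
  · intro h
    exact ⟨hu1.locallyIntegrableOn, hg1.locallyIntegrableOn, fun φ hφ => (key φ hφ).2 (h φ hφ)⟩

/-- The fundamental lemma of the calculus of variations, applied to the difference of the two
gradients. -/
lemma IsWeakGrad.ae_eq (hΩ : IsOpen Ω) {u : E m → ℝ} {g g' : E m → E m}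
    (h : IsWeakGrad Ω u g) (h' : IsWeakGrad Ω u g') : g =ᵐ[volume.restrict Ω] g' := by
  have h0 : ∀ᵐ x ∂volume, x ∈ Ω → (g - g') x = 0 := by
    refine hΩ.ae_eq_zero_of_integral_contDiff_smul_eq_zero (h.2.1.sub h'.2.1) ?_
    intro φ h1 h2 h3
    have ht : IsTestFunction Ω φ := ⟨h1, h2, h3⟩
    rw [← setIntegral_eq_integral_of_forall_compl_eq_zero (s := Ω)
      (fun x hx => by simp [ht.eq_zero hx])]
    have hint : ∀ {k : E m → E m}, LocallyIntegrableOn k Ω →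
        Integrable (fun x => φ x • k x) (volume.restrict Ω) := by
      intro k hk
      have h4 : IntegrableOn k (tsupport φ) := hk.integrableOn_compact_subset h3 h2
      have h5 : IntegrableOn (fun x => φ x • k x) (tsupport φ) :=
        h4.continuousOn_smul ht.continuous.continuousOn h2
      have h6 : Integrable (fun x => φ x • k x) volume := by
        rw [← integrableOn_iff_integrable_of_support_subset (s := tsupport φ)]
        · exact h5
        · exact fun x hx => subset_tsupport _ fun h0 => hx (by simp [h0])
      exact h6.restrict
    simp only [Pi.sub_apply, smul_sub]
    rw [integral_sub (hint h.2.1) (hint h'.2.1), sub_eq_zero]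
    have := (h.2.2 φ ht).symm.trans (h'.2.2 φ ht)
    exact neg_injective this
  filter_upwards [(ae_restrict_iff' hΩ.measurableSet).2 h0] with x hx
  simpa [sub_eq_zero] using hx

lemma IsWeakGrad.weakGrad_ae_eq (hΩ : IsOpen Ω) {u : E m → ℝ} {g : E m → E m}
    (h : IsWeakGrad Ω u g) : weakGrad Ω u =ᵐ[volume.restrict Ω] g := by
  have hex : ∃ g, IsWeakGrad Ω u g := ⟨g, h⟩
  have : weakGrad Ω u = hex.choose := by simp [weakGrad, hex]
  rw [this]
  exact hex.choose_spec.ae_eq hΩ h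

/-- `u ∈ H¹(Ω)` with weak gradient `g`. -/
structure H1Pair (Ω : Set (E m)) (u : E m → ℝ) (g : E m → E m) : Prop where
  memLp : MemLp u 2 (volume.restrict Ω)
  memLp_grad : MemLp g 2 (volume.restrict Ω)
  isWeakGrad : IsWeakGrad Ω u g

/-- `(u, g)` is a limit of pairs `(φ, ∇φ)` with test functions `φ`. -/
structure H10Pair (Ω : Set (E m)) (u : E m → ℝ) (g : E m → E m) : Prop where
  memLp : MemLp u 2 (volume.restrict Ω)
  memLp_grad : MemLp g 2 (volume.restrict Ω)
  exists_tendsto : ∃ φ : ℕ → E m → ℝ, (∀ k, IsTestFunction Ω (φ k)) ∧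
    Tendsto (fun k => eLpNorm (fun x => u x - φ k x) 2 (volume.restrict Ω)) atTop (𝓝 0) ∧
    Tendsto (fun k => eLpNorm (fun x => g x - gradient (φ k) x) 2
      (volume.restrict Ω)) atTop (𝓝 0)

lemma IsTestFunction.h10Pair {φ : E m → ℝ} (h : IsTestFunction Ω φ) :
    H10Pair Ω φ (gradient φ) :=
  ⟨h.memLp, h.memLp_gradient, fun _ => φ, fun _ => h, by simp, by simp⟩

lemma H1Pair.memH1 {u : E m → ℝ} {g : E m → E m} (h : H1Pair Ω u g) : MemH1 Ω u :=
  ⟨h.memLp, g, h.isWeakGrad, h.memLp_grad⟩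

/-- Integration by parts holds for the approximating test functions, and both sides pass to the L²
limit. -/
lemma H10Pair.h1Pair (hΩ : volume Ω ≠ ⊤) {u : E m → ℝ} {g : E m → E m} (h : H10Pair Ω u g) :
    H1Pair Ω u g := by
  refine ⟨h.memLp, h.memLp_grad, (isWeakGrad_iff hΩ h.memLp h.memLp_grad).2 ?_⟩
  intro χ hχ v
  obtain ⟨φ, hφ, h1, h2⟩ := h.exists_tendsto
  have hχ' : MemLp (fun x => inner ℝ (gradient χ x) v) 2 (volume.restrict Ω) :=
    hχ.memLp_gradient.inner_const v
  have t1 := tendsto_integral_inner h.memLp (fun k => (hφ k).memLp) hχ' h1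
  have hχ'' : MemLp (fun x => χ x • v) 2 (volume.restrict Ω) :=
    ((hχ.continuous.smul continuous_const).memLp_of_hasCompactSupport hχ.2.1.smul_right).restrict _
  have t2 := tendsto_integral_inner h.memLp_grad (fun k => (hφ k).memLp_gradient) hχ'' h2
  simp only [inner_smul_right, RCLike.inner_apply, conj_trivial] at t1 t2
  have e : ∀ k, ∫ x in Ω, inner ℝ (gradient χ x) v * φ k x =
      -∫ x in Ω, χ x * inner ℝ (gradient (φ k) x) v := fun k => by
    rw [← (hφ k).integral_mul_inner_gradient hχ v]; simp [mul_comm]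
  simp only [e] at t1
  have := tendsto_nhds_unique t1 t2.neg
  rw [← this]; simp [mul_comm]

lemma H1Pair.weakGrad_ae_eq (hΩ : IsOpen Ω) {u : E m → ℝ} {g : E m → E m} (h : H1Pair Ω u g) :
    weakGrad Ω u =ᵐ[volume.restrict Ω] g := h.isWeakGrad.weakGrad_ae_eq hΩ

lemma H10Pair.congr {u u' : E m → ℝ} {g g' : E m → E m} (h : H10Pair Ω u g)
    (hu : u =ᵐ[volume.restrict Ω] u') (hg : g =ᵐ[volume.restrict Ω] g') : H10Pair Ω u' g' := by
  obtain ⟨φ, hφ, h1, h2⟩ := h.exists_tendsto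
  refine ⟨h.memLp.ae_eq hu, h.memLp_grad.ae_eq hg, φ, hφ, h1.congr fun k => ?_,
    h2.congr fun k => ?_⟩
  · exact eLpNorm_congr_ae (by filter_upwards [hu] with x hx; rw [hx])
  · exact eLpNorm_congr_ae (by filter_upwards [hg] with x hx; rw [hx])

lemma MemH1.h1Pair (hΩ : IsOpen Ω) {u : E m → ℝ} (h : MemH1 Ω u) : H1Pair Ω u (weakGrad Ω u) := by
  obtain ⟨hu, g, hg, hg2⟩ := h
  have hae := hg.weakGrad_ae_eq hΩ
  have hex : ∃ g, IsWeakGrad Ω u g := ⟨g, hg⟩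
  have : weakGrad Ω u = hex.choose := by simp [weakGrad, hex]
  exact ⟨hu, hg2.ae_eq hae.symm, this ▸ hex.choose_spec⟩

lemma MemH10.h10Pair (hΩ : IsOpen Ω) {u : E m → ℝ} (h : MemH10 Ω u) :
    H10Pair Ω u (weakGrad Ω u) :=
  ⟨h.1.1, (h.1.h1Pair hΩ).memLp_grad, h.2⟩

lemma H10Pair.memH10 (hΩ : IsOpen Ω) (hfin : volume Ω ≠ ⊤) {u : E m → ℝ} {g : E m → E m}
    (h : H10Pair Ω u g) : MemH10 Ω u := by
  have h1 := h.h1Pair hfin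
  have hae := h1.weakGrad_ae_eq hΩ
  have h' := h.congr (ae_eq_refl u) hae.symm
  exact ⟨h1.memH1, h'.exists_tendsto⟩

lemma IsTestFunction.add {φ χ : E m → ℝ} (h : IsTestFunction Ω φ) (h' : IsTestFunction Ω χ) :
    IsTestFunction Ω (φ + χ) :=
  ⟨h.1.add h'.1, h.2.1.add h'.2.1, (tsupport_add φ χ).trans (Set.union_subset h.2.2 h'.2.2)⟩

lemma IsTestFunction.const_smul {φ : E m → ℝ} (h : IsTestFunction Ω φ) (c : ℝ) :
    IsTestFunction Ω (c • φ) :=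
  ⟨h.1.const_smul c, h.2.1.smul_left (f := fun _ => c),
    (tsupport_smul_subset_right (fun _ => c) φ).trans h.2.2⟩

lemma gradient_add' {φ χ : E m → ℝ} {x : E m} (h : DifferentiableAt ℝ φ x)
    (h' : DifferentiableAt ℝ χ x) : gradient (φ + χ) x = gradient φ x + gradient χ x := by
  simp [gradient, fderiv_add h h']

lemma gradient_const_smul' {φ : E m → ℝ} {x : E m} (h : DifferentiableAt ℝ φ x) (c : ℝ) :
    gradient (c • φ) x = c • gradient φ x := by
  simp [gradient, fderiv_const_smul h]

lemma tendsto_eLpNorm_add {X F : Type*} [MeasurableSpace X] {μ : Measure X}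
    [NormedAddCommGroup F] {f h : ℕ → X → F}
    (hf : ∀ k, AEStronglyMeasurable (f k) μ) (hh : ∀ k, AEStronglyMeasurable (h k) μ)
    (h1 : Tendsto (fun k => eLpNorm (f k) 2 μ) atTop (𝓝 0))
    (h2 : Tendsto (fun k => eLpNorm (h k) 2 μ) atTop (𝓝 0)) :
    Tendsto (fun k => eLpNorm (f k + h k) 2 μ) atTop (𝓝 0) := by
  have := h1.add h2
  rw [add_zero] at this
  exact tendsto_of_tendsto_of_tendsto_of_le_of_le tendsto_const_nhds this (fun _ => zero_le)
    fun k => eLpNorm_add_le (hf k) (hh k) (by norm_num)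

lemma H10Pair.add {u u' : E m → ℝ} {g g' : E m → E m} (h : H10Pair Ω u g)
    (h' : H10Pair Ω u' g') : H10Pair Ω (u + u') (g + g') := by
  obtain ⟨φ, hφ, h1, h2⟩ := h.exists_tendsto
  obtain ⟨χ, hχ, h3, h4⟩ := h'.exists_tendsto
  refine ⟨h.memLp.add h'.memLp, h.memLp_grad.add h'.memLp_grad, fun k => φ k + χ k,
    fun k => (hφ k).add (hχ k), ?_, ?_⟩
  · refine (tendsto_eLpNorm_add (fun k => ?_) (fun k => ?_) h1 h3).congr fun k => ?_
    · exact (h.memLp.sub (hφ k).memLp).1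
    · exact (h'.memLp.sub (hχ k).memLp).1
    · congr 1; ext x; simp; ring
  · refine (tendsto_eLpNorm_add (fun k => ?_) (fun k => ?_) h2 h4).congr fun k => ?_
    · exact (h.memLp_grad.sub (hφ k).memLp_gradient).1
    · exact (h'.memLp_grad.sub (hχ k).memLp_gradient).1
    · congr 1; ext1 x
      rw [gradient_add' ((hφ k).differentiable x) ((hχ k).differentiable x)]
      simp only [Pi.add_apply]; abel

lemma H10Pair.const_smul {u : E m → ℝ} {g : E m → E m} (h : H10Pair Ω u g) (c : ℝ) :
    H10Pair Ω (c • u) (c • g) := by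
  obtain ⟨φ, hφ, h1, h2⟩ := h.exists_tendsto
  refine ⟨h.memLp.const_smul c, h.memLp_grad.const_smul c, fun k => c • φ k,
    fun k => (hφ k).const_smul c, ?_, ?_⟩
  · have := ENNReal.Tendsto.const_mul (a := ‖c‖ₑ) h1 (Or.inr (by simp))
    rw [mul_zero] at this
    refine this.congr fun k => ?_
    rw [← eLpNorm_const_smul]
    congr 1; ext x; simp; ring
  · have := ENNReal.Tendsto.const_mul (a := ‖c‖ₑ) h2 (Or.inr (by simp))
    rw [mul_zero] at this
    refine this.congr fun k => ?_
    rw [← eLpNorm_const_smul]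
    congr 1; ext1 x
    rw [gradient_const_smul' ((hφ k).differentiable x)]
    simp [smul_sub]

lemma H1Pair.sub (hΩ : volume Ω ≠ ⊤) {u u' : E m → ℝ} {g g' : E m → E m} (h : H1Pair Ω u g)
    (h' : H1Pair Ω u' g') : H1Pair Ω (u - u') (g - g') := by
  have hu := h.memLp.sub h'.memLp
  have hg := h.memLp_grad.sub h'.memLp_grad
  refine ⟨hu, hg, (isWeakGrad_iff hΩ hu hg).2 fun φ hφ v => ?_⟩
  have e1 := (isWeakGrad_iff hΩ h.memLp h.memLp_grad).1 h.isWeakGrad φ hφ v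
  have e2 := (isWeakGrad_iff hΩ h'.memLp h'.memLp_grad).1 h'.isWeakGrad φ hφ v
  have hφ' : MemLp (fun x => inner ℝ (gradient φ x) v) 2 (volume.restrict Ω) :=
    hφ.memLp_gradient.inner_const v
  have i1 : ∀ {w : E m → ℝ}, MemLp w 2 (volume.restrict Ω) →
      Integrable (fun x => w x * inner ℝ (gradient φ x) v) (volume.restrict Ω) :=
    fun hw => hw.integrable_mul hφ'
  have i2 : ∀ {w : E m → E m}, MemLp w 2 (volume.restrict Ω) →
      Integrable (fun x => φ x * inner ℝ (w x) v) (volume.restrict Ω) :=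
    fun hw => (hφ.memLp (p := 2)).integrable_mul (hw.inner_const v)
  simp only [Pi.sub_apply, sub_mul, inner_sub_left, mul_sub]
  rw [integral_sub (i1 h.memLp) (i1 h'.memLp), integral_sub (i2 h.memLp_grad) (i2 h'.memLp_grad),
    e1, e2]
  ring

end

/-! ### The Poincaré inequality and positivity of λ₁. -/

section

variable {m d : ℕ} {Ω : Set (E m)} {S : Set (E d)}

lemma l2norm_eq_toReal {V : Type} [NormedAddCommGroup V] {u : E m → V}
    (hu : MemLp u 2 (volume.restrict Ω)) :
    l2norm Ω u = (eLpNorm u 2 (volume.restrict Ω)).toReal := by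
  rw [hu.eLpNorm_eq_integral_rpow_norm (by norm_num) (by norm_num), l2norm, Real.sqrt_eq_rpow,
    ENNReal.toReal_ofReal (by positivity)]
  norm_num

lemma l2norm_congr {V : Type} [NormedAddCommGroup V] {u v : E m → V}
    (h : u =ᵐ[volume.restrict Ω] v) : l2norm Ω u = l2norm Ω v := by
  unfold l2norm
  congr 1
  exact integral_congr_ae (by filter_upwards [h] with x hx; rw [hx])

lemma l2norm_nonneg {V : Type} [NormedAddCommGroup V] (Ω : Set (E m)) (u : E m → V) :
    0 ≤ l2norm Ω u := Real.sqrt_nonneg _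

lemma sq_l2norm {V : Type} [NormedAddCommGroup V] (Ω : Set (E m)) (u : E m → V) :
    l2norm Ω u ^ 2 = ∫ x in Ω, ‖u x‖ ^ 2 :=
  Real.sq_sqrt (integral_nonneg fun _ => by positivity)

lemma IsTestFunction.integrable_sq_gradient {φ : E d → ℝ} (h : IsTestFunction S φ) :
    Integrable (fun x => ‖gradient φ x‖ ^ 2) volume := by
  have h1 : MemLp (gradient φ) (2 : ℕ) volume :=
    h.continuous_gradient.memLp_of_hasCompactSupport h.hasCompactSupport_gradient
  exact h1.integrable_norm_pow (by norm_num)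

/-- The Poincaré inequality for test functions supported in a slab. -/
lemma IsTestFunction.l2norm_le {φ : E d → ℝ} (h : IsTestFunction S φ) (i : Fin d) {R : ℝ}
    (hR : 0 ≤ R) (hS : ∀ x ∈ S, |x i| ≤ R) : l2norm S φ ≤ 2 * R * l2norm S (gradient φ) := by
  have hsq : l2norm S φ ^ 2 ≤ (2 * R * l2norm S (gradient φ)) ^ 2 := by
    rw [mul_pow, sq_l2norm, sq_l2norm]
    rw [setIntegral_eq_integral_of_forall_compl_eq_zero (fun x hx => by simp [h.eq_zero hx]),
      setIntegral_eq_integral_of_forall_compl_eq_zero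
        (fun x hx => by simp [h.gradient_eq_zero hx])]
    set e : E d := EuclideanSpace.single i 1
    have he : ‖e‖ = 1 := by simp [e]
    have hcoord : ∀ x : E d,
        HasFDerivAt (fun x : E d => x i) (EuclideanSpace.proj i : E d →L[ℝ] ℝ) x :=
      fun x => (EuclideanSpace.proj i : E d →L[ℝ] ℝ).hasFDerivAt
    have hcc : Continuous fun x : E d => x i := (EuclideanSpace.proj i : E d →L[ℝ] ℝ).continuous
    have hdc : Continuous fun x => fderiv ℝ φ x e := h.continuous_fderiv.clm_apply continuous_const
    have hder : ∀ x, fderiv ℝ (fun x : E d => x i * φ x) x e = φ x + x i * fderiv ℝ φ x e := by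
      intro x
      rw [((hcoord x).fun_mul (h.differentiable x).hasFDerivAt).fderiv]
      simp [e]; ring
    have i1 : Integrable (fun x => φ x * φ x) volume :=
      (h.continuous.mul h.continuous).integrable_of_hasCompactSupport h.2.1.mul_right
    have i2 : Integrable (fun x => x i * φ x * fderiv ℝ φ x e) volume :=
      ((hcc.mul h.continuous).mul hdc).integrable_of_hasCompactSupport h.2.1.mul_left.mul_right
    have i3 := h.integrable_sq_gradient
    -- Moving ∂ᵢ off the second factor in ∫ (xᵢ φ) ∂ᵢφ gives ∫ φ² = -2 ∫ xᵢ φ ∂ᵢφ.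
    have ibp := integral_mul_fderiv_eq_neg_fderiv_mul_of_integrable
      (μ := (volume : Measure (E d))) (f := fun x : E d => x i * φ x) (g := φ) (v := e)
      (by
        simp only [hder]
        refine (i1.add i2).congr (Eventually.of_forall fun x => ?_)
        simp; ring) i2
      (by
        refine (hcc.mul h.continuous).mul h.continuous |>.integrable_of_hasCompactSupport
          h.2.1.mul_left)
      (fun x _ => ((hcoord x).fun_mul (h.differentiable x).hasFDerivAt).differentiableAt)
      (fun x _ => h.differentiable x)
    simp only [hder] at ibp
    have e2 : ∫ x, (φ x + x i * fderiv ℝ φ x e) * φ x =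
        (∫ x, φ x * φ x) + ∫ x, x i * φ x * fderiv ℝ φ x e := by
      rw [← integral_add i1 i2]; congr 1; ext x; ring
    rw [e2] at ibp
    -- Young's inequality with weight 1/2: half of ∫ φ² is absorbed, leaving ∫ φ² ≤ 4R² ∫ |∇φ|².
    have hle : ∫ x, -2 * (x i * φ x * fderiv ℝ φ x e) ≤
        ∫ x, (1 / 2 * (φ x * φ x) + 2 * R ^ 2 * ‖gradient φ x‖ ^ 2) := by
      refine integral_mono (i2.const_mul _) ((i1.const_mul _).add (i3.const_mul _)) fun x => ?_
      by_cases hx : x ∈ S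
      · have hD : |fderiv ℝ φ x e| ≤ ‖gradient φ x‖ := by
          rw [← inner_gradient_left]
          simpa [he] using abs_real_inner_le_norm (gradient φ x) e
        have h2 : (x i * fderiv ℝ φ x e) ^ 2 ≤ R ^ 2 * ‖gradient φ x‖ ^ 2 := by
          rw [← mul_pow, ← sq_abs, abs_mul]
          gcongr
          exact hS x hx
        simp only
        nlinarith [sq_nonneg (φ x + 2 * (x i * fderiv ℝ φ x e))]
      · simp [h.eq_zero hx]; positivity
    rw [integral_add (i1.const_mul _) (i3.const_mul _), integral_const_mul, integral_const_mul,
      integral_const_mul] at hle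
    have e3 : ∫ x, ‖φ x‖ ^ 2 = ∫ x, φ x * φ x := by
      congr 1; ext x; simp [sq]
    rw [e3]
    nlinarith
  exact le_of_sq_le_sq hsq (by have := l2norm_nonneg S (gradient φ); positivity)

/-- A bounded set lies in a slab in its first coordinate, which exists as `1 ≤ d`; the inequality
for test functions passes to the limit. -/
lemma H10Pair.l2norm_le (hd : 1 ≤ d) (hS : Bornology.IsBounded S) :
    ∃ C > (0 : ℝ), ∀ u g, H10Pair S u g → l2norm S u ≤ C * l2norm S g := by
  obtain ⟨R, hR, hRS⟩ := hS.exists_pos_norm_le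
  refine ⟨2 * R, by positivity, fun u g h => ?_⟩
  obtain ⟨φ, hφ, h1, h2⟩ := h.exists_tendsto
  rw [l2norm_eq_toReal h.memLp, l2norm_eq_toReal h.memLp_grad]
  refine le_of_tendsto_of_tendsto' (eLpNorm_tendsto_of_sub h.memLp (fun k => (hφ k).memLp) h1)
    ((eLpNorm_tendsto_of_sub h.memLp_grad (fun k => (hφ k).memLp_gradient) h2).const_mul (2 * R))
    fun k => ?_
  rw [← l2norm_eq_toReal (hφ k).memLp, ← l2norm_eq_toReal (hφ k).memLp_gradient]
  exact (hφ k).l2norm_le ⟨0, hd⟩ hR.le fun x hx => (PiLp.norm_apply_le x _).trans (hRS x hx)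

lemma H10Pair.l2norm_weakGrad (hS : IsOpen S) (hfin : volume S ≠ ⊤) {u : E d → ℝ} {g : E d → E d}
    (h : H10Pair S u g) : l2norm S (weakGrad S u) = l2norm S g :=
  l2norm_congr ((h.h1Pair hfin).weakGrad_ae_eq hS)

lemma lambdaOne_mul_le (hS : IsOpen S) (hfin : volume S ≠ ⊤) {u : E d → ℝ} {g : E d → E d}
    (h : H10Pair S u g) : lambdaOne S * l2norm S u ≤ l2norm S g := by
  by_cases h0 : l2norm S u = 0
  · simp [h0, l2norm_nonneg]
  · have hpos : 0 < l2norm S u := lt_of_le_of_ne (l2norm_nonneg _ _) (Ne.symm h0)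
    rw [← le_div_iff₀ hpos, ← h.l2norm_weakGrad hS hfin]
    refine csInf_le ⟨0, ?_⟩ ⟨u, h.memH10 hS hfin, h0, rfl⟩
    rintro r ⟨v, -, -, rfl⟩
    exact div_nonneg (l2norm_nonneg _ _) (l2norm_nonneg _ _)

lemma lambdaOne_pos (hd : 1 ≤ d) (hS : IsOpen S) (hb : Bornology.IsBounded S)
    (hne : S.Nonempty) : 0 < lambdaOne S := by
  have hfin : volume S ≠ ⊤ := hb.measure_lt_top.ne
  obtain ⟨C, hC, hP⟩ := H10Pair.l2norm_le hd hb
  refine lt_of_lt_of_le (inv_pos.2 hC) (le_csInf ?_ ?_)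
  -- The real `sInf` of the empty set is 0, so positivity requires an admissible quotient; a bump
  -- function in `S` provides one.
  · obtain ⟨x, hx⟩ := hne
    obtain ⟨f, hf1, hf2, hf3, -, hf5⟩ := exists_contDiff_tsupport_subset
      (n := ⊤) (hS.mem_nhds hx)
    have ht : IsTestFunction S f := ⟨hf3, hf2, hf1⟩
    refine ⟨_, f, ht.h10Pair.memH10 hS hfin, ?_, rfl⟩
    have hpos : 0 < ∫ y in S, ‖f y‖ ^ 2 := by
      rw [setIntegral_eq_integral_of_forall_compl_eq_zero (fun y hy => by simp [ht.eq_zero hy])]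
      refine (hf3.continuous.norm.pow 2).integral_pos_of_hasCompactSupport_nonneg_nonzero (x := x)
        (hf2.comp_left (g := fun y => ‖y‖ ^ 2) (by simp)) (fun y => by positivity) ?_
      simp [hf5]
    exact (Real.sqrt_pos.2 hpos).ne'
  · rintro r ⟨v, hv, hv0, rfl⟩
    have hpos : 0 < l2norm S v := lt_of_le_of_ne (l2norm_nonneg _ _) (Ne.symm hv0)
    rw [le_div_iff₀ hpos, inv_mul_le_iff₀ hC]
    exact hP _ _ (hv.h10Pair hS)

end

/-! ### The splitting x = (x₁, x'), and tensor products in L². -/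

section

variable {d : ℕ} {S : Set (E d)}

/-- The splitting `x = (x₁, x')` as a measurable equivalence. -/
noncomputable def splitEquiv (d : ℕ) : E (d + 1) ≃ᵐ ℝ × E d :=
  (MeasurableEquiv.toLp 2 (Fin (d + 1) → ℝ)).symm.trans
    ((MeasurableEquiv.piFinSuccAbove (fun _ => ℝ) 0).trans
      ((MeasurableEquiv.refl ℝ).prodCongr (MeasurableEquiv.toLp 2 (Fin d → ℝ))))

lemma splitEquiv_apply (x : E (d + 1)) : splitEquiv d x = (x 0, crossPart x) := rfl

lemma measurePreserving_splitEquiv : MeasurePreserving (splitEquiv d) volume volume := by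
  have h1 := EuclideanSpace.volume_preserving_symm_measurableEquiv_toLp (Fin (d + 1))
  have h2 := volume_preserving_piFinSuccAbove (fun _ : Fin (d + 1) => ℝ) 0
  have h3 := (MeasurePreserving.id (volume : Measure ℝ)).prod
    (EuclideanSpace.volume_preserving_symm_measurableEquiv_toLp (Fin d)).symm
  exact (h3.comp h2).comp h1

/-- The product measure on `(-s, s) × S`. -/
noncomputable abbrev boxMeasure (S : Set (E d)) (s : ℝ) : Measure (ℝ × E d) :=
  (volume.restrict (Set.Ioo (-s) s)).prod (volume.restrict S)

lemma longDomain_eq (S : Set (E d)) (s : ℝ) :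
    longDomain S s = splitEquiv d ⁻¹' (Set.Ioo (-s) s ×ˢ S) := rfl

lemma measurePreserving_split_longDomain (hS : MeasurableSet S) (s : ℝ) :
    MeasurePreserving (splitEquiv d) (volume.restrict (longDomain S s)) (boxMeasure S s) := by
  rw [boxMeasure, Measure.prod_restrict, longDomain_eq]
  exact measurePreserving_splitEquiv.restrict_preimage (measurableSet_Ioo.prod hS)

lemma setIntegral_longDomain (hS : MeasurableSet S) (s : ℝ) {F : Type*} [NormedAddCommGroup F]
    [NormedSpace ℝ F] (f : ℝ × E d → F) :
    ∫ x in longDomain S s, f (x 0, crossPart x) = ∫ z, f z ∂boxMeasure S s :=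
  (measurePreserving_split_longDomain hS s).integral_comp (splitEquiv d).measurableEmbedding f

lemma setIntegral_longDomain_mul (hS : MeasurableSet S) (s : ℝ) (p : ℝ → ℝ) (h : E d → ℝ) :
    ∫ x in longDomain S s, p (x 0) * h (crossPart x) =
      (∫ t in Set.Ioo (-s) s, p t) * ∫ y in S, h y := by
  rw [setIntegral_longDomain hS s (fun z => p z.1 * h z.2)]
  exact integral_prod_mul p h

lemma ae_longDomain_of_ae (hS : MeasurableSet S) (s : ℝ) {P : E d → Prop}
    (h : ∀ᵐ y ∂volume.restrict S, P y) :
    ∀ᵐ x ∂volume.restrict (longDomain S s), P (crossPart x) := by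
  have h1 : ∀ᵐ z ∂boxMeasure S s, P z.2 := Measure.quasiMeasurePreserving_snd.ae h
  exact (measurePreserving_split_longDomain hS s).quasiMeasurePreserving.ae h1

/-- The vector-valued tensor product `p ⊗ h`. -/
def vtensor {F : Type*} [NormedAddCommGroup F] [NormedSpace ℝ F] (p : ℝ → ℝ) (h : E d → F) :
    E (d + 1) → F := fun x => p (x 0) • h (crossPart x)

lemma eLpNorm_two_eq {X G : Type*} [MeasurableSpace X] [NormedAddCommGroup G] (μ : Measure X)
    (f : X → G) : eLpNorm f 2 μ = (∫⁻ x, ‖f x‖ₑ ^ (2 : ℝ) ∂μ) ^ (1 / 2 : ℝ) := by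
  rw [eLpNorm_eq_lintegral_rpow_enorm_toReal (by norm_num) (by norm_num)]
  simp

section vtensor
variable {F : Type*} [NormedAddCommGroup F] [NormedSpace ℝ F] {p : ℝ → ℝ} {h : E d → F} {s : ℝ}

lemma aestronglyMeasurable_vtensor (hS : MeasurableSet S)
    (hp : AEStronglyMeasurable p (volume.restrict (Set.Ioo (-s) s)))
    (hh : AEStronglyMeasurable h (volume.restrict S)) :
    AEStronglyMeasurable (vtensor p h) (volume.restrict (longDomain S s)) := by
  have : AEStronglyMeasurable (fun z : ℝ × E d => p z.1 • h z.2) (boxMeasure S s) :=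
    hp.comp_fst.smul hh.comp_snd
  exact this.comp_measurePreserving (measurePreserving_split_longDomain hS s)

/-- Tonelli's theorem on the product (-s, s) × S. -/
lemma eLpNorm_vtensor (hS : MeasurableSet S)
    (hp : AEStronglyMeasurable p (volume.restrict (Set.Ioo (-s) s)))
    (hh : AEStronglyMeasurable h (volume.restrict S)) :
    eLpNorm (vtensor p h) 2 (volume.restrict (longDomain S s)) =
      eLpNorm p 2 (volume.restrict (Set.Ioo (-s) s)) * eLpNorm h 2 (volume.restrict S) := by
  have hm : AEStronglyMeasurable (fun z : ℝ × E d => p z.1 • h z.2) (boxMeasure S s) :=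
    hp.comp_fst.smul hh.comp_snd
  have e0 : vtensor p h = (fun z : ℝ × E d => p z.1 • h z.2) ∘ splitEquiv d := by
    ext1 x; rw [Function.comp_apply, splitEquiv_apply, vtensor]
  have e1 : eLpNorm (vtensor p h) 2 (volume.restrict (longDomain S s)) =
      eLpNorm (fun z : ℝ × E d => p z.1 • h z.2) 2 (boxMeasure S s) := by
    rw [e0]
    exact eLpNorm_comp_measurePreserving hm (measurePreserving_split_longDomain hS s)
  have e3 : ∫⁻ z, ‖p z.1 • h z.2‖ₑ ^ (2 : ℝ) ∂boxMeasure S s =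
      ∫⁻ z, ‖p z.1‖ₑ ^ (2 : ℝ) * ‖h z.2‖ₑ ^ (2 : ℝ) ∂boxMeasure S s := by
    refine lintegral_congr fun z => ?_
    rw [enorm_smul, ENNReal.mul_rpow_of_nonneg _ _ (by norm_num)]
  rw [e1, eLpNorm_two_eq, e3, lintegral_prod_mul (f := fun t => ‖p t‖ₑ ^ (2 : ℝ))
    (g := fun y => ‖h y‖ₑ ^ (2 : ℝ)) (hp.enorm.pow_const _) (hh.enorm.pow_const _),
    ENNReal.mul_rpow_of_nonneg _ _ (by norm_num), 
    ← eLpNorm_two_eq, ← eLpNorm_two_eq]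

lemma memLp_vtensor (hS : MeasurableSet S)
    (hp : MemLp p 2 (volume.restrict (Set.Ioo (-s) s)))
    (hh : MemLp h 2 (volume.restrict S)) :
    MemLp (vtensor p h) 2 (volume.restrict (longDomain S s)) := by
  refine ⟨aestronglyMeasurable_vtensor hS hp.1 hh.1, ?_⟩
  rw [eLpNorm_vtensor hS hp.1 hh.1]
  exact ENNReal.mul_lt_top hp.2 hh.2

lemma tendsto_eLpNorm_vtensor_sub (hS : MeasurableSet S) {pk : ℕ → ℝ → ℝ} {hk : ℕ → E d → F}
    (hp : MemLp p 2 (volume.restrict (Set.Ioo (-s) s))) (hh : MemLp h 2 (volume.restrict S))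
    (hpk : ∀ k, MemLp (pk k) 2 (volume.restrict (Set.Ioo (-s) s)))
    (hhk : ∀ k, MemLp (hk k) 2 (volume.restrict S))
    (h1 : Tendsto (fun k => eLpNorm (fun t => p t - pk k t) 2
      (volume.restrict (Set.Ioo (-s) s))) atTop (𝓝 0))
    (h2 : Tendsto (fun k => eLpNorm (fun y => h y - hk k y) 2 (volume.restrict S)) atTop (𝓝 0)) :
    Tendsto (fun k => eLpNorm (fun x => vtensor p h x - vtensor (pk k) (hk k) x) 2
      (volume.restrict (longDomain S s))) atTop (𝓝 0) := by
  have t1 := ENNReal.Tendsto.mul_const (b := eLpNorm h 2 (volume.restrict S)) h1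
    (Or.inr hh.2.ne)
  have t2 := ENNReal.Tendsto.const_mul (a := eLpNorm p 2 (volume.restrict (Set.Ioo (-s) s))) h2
    (Or.inr hp.2.ne)
  have t3 := ENNReal.Tendsto.mul h1 (Or.inr (by simp)) h2 (Or.inr (by simp))
  have t := (t1.add t2).add t3
  simp only [zero_mul, mul_zero, add_zero] at t
  refine tendsto_of_tendsto_of_tendsto_of_le_of_le tendsto_const_nhds t (fun _ => zero_le)
    fun k => ?_
  have hdp : MemLp (fun t => p t - pk k t) 2 (volume.restrict (Set.Ioo (-s) s)) :=
    hp.sub (hpk k)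
  have hdh : MemLp (fun y => h y - hk k y) 2 (volume.restrict S) := hh.sub (hhk k)
  -- In this expansion each term has a factor that is a difference, the other being fixed or also a
  -- difference, so no bound on the approximants is needed.
  have e : (fun x => vtensor p h x - vtensor (pk k) (hk k) x) =
      (vtensor (fun t => p t - pk k t) h + vtensor p (fun y => h y - hk k y)) -
        vtensor (fun t => p t - pk k t) (fun y => h y - hk k y) := by
    ext1 x
    simp only [vtensor, Pi.add_apply, Pi.sub_apply, sub_smul, smul_sub]
    abel
  rw [e]
  simp only
  rw [← eLpNorm_vtensor hS hdp.1 hh.1, ← eLpNorm_vtensor hS hp.1 hdh.1,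
    ← eLpNorm_vtensor hS hdp.1 hdh.1]
  have m1 := (memLp_vtensor hS hdp hh).1
  have m2 := (memLp_vtensor hS hp hdh).1
  have m3 := (memLp_vtensor hS hdp hdh).1
  refine (eLpNorm_sub_le (m1.add m2) m3 (by norm_num)).trans ?_
  gcongr
  exact eLpNorm_add_le m1 m2 (by norm_num)

end vtensor

/-- The embedding `v ↦ (0, v)`. -/
noncomputable def crossEmb (d : ℕ) : E d →L[ℝ] E (d + 1) :=
  LinearMap.toContinuousLinearMap
    { toFun := fun v => WithLp.toLp 2 (Fin.cons 0 fun i => v i)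
      map_add' := by
        intro v w; ext i; refine Fin.cases ?_ (fun j => ?_) i <;> simp
      map_smul' := by
        intro c v; ext i; refine Fin.cases ?_ (fun j => ?_) i <;> simp }

/-- The projection `x ↦ x'` as a continuous linear map. -/
noncomputable def crossProj (d : ℕ) : E (d + 1) →L[ℝ] E d :=
  LinearMap.toContinuousLinearMap
    { toFun := crossPart
      map_add' := by intro v w; ext i; simp [crossPart]
      map_smul' := by intro c v; ext i; simp [crossPart] }

lemma crossProj_apply (x : E (d + 1)) : crossProj d x = crossPart x := rfl

lemma continuous_crossPart : Continuous (crossPart (d := d)) := (crossProj d).continuous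

/-- The first unit vector. -/
noncomputable def axis (d : ℕ) : E (d + 1) := EuclideanSpace.single 0 1

@[simp] lemma crossEmb_zero_coord (v : E d) : crossEmb d v 0 = 0 := rfl
@[simp] lemma crossEmb_succ (v : E d) (i : Fin d) : crossEmb d v i.succ = v i := rfl
@[simp] lemma axis_zero_coord : axis d 0 = 1 := by simp [axis]
@[simp] lemma axis_succ (i : Fin d) : axis d i.succ = 0 := by simp [axis]
@[simp] lemma crossPart_apply (x : E (d + 1)) (i : Fin d) : crossPart x i = x i.succ := rfl

lemma inner_split (x y : E (d + 1)) :
    inner ℝ x y = x 0 * y 0 + inner ℝ (crossPart x) (crossPart y) := by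
  simp [PiLp.inner_apply, Fin.sum_univ_succ, mul_comm]

@[simp] lemma crossPart_crossEmb (v : E d) : crossPart (crossEmb d v) = v := by
  ext i; simp

@[simp] lemma crossPart_axis : crossPart (axis d) = 0 := by
  ext i; simp

lemma norm_axis : ‖axis d‖ = 1 := by simp [axis]

lemma norm_crossEmb (v : E d) : ‖crossEmb d v‖ = ‖v‖ := by
  have : ‖crossEmb d v‖ ^ 2 = ‖v‖ ^ 2 := by
    rw [← real_inner_self_eq_norm_sq, ← real_inner_self_eq_norm_sq, inner_split]; simp
  exact (sq_eq_sq₀ (norm_nonneg _) (norm_nonneg _)).1 this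

lemma split_eq (x : E (d + 1)) : x 0 • axis d + crossEmb d (crossPart x) = x := by
  ext i; refine Fin.cases ?_ (fun j => ?_) i <;> simp

/-- The gradient `(p' ⊗ u, p ⊗ g)` of `p ⊗ u`, where `g` is the gradient of `u`. -/
noncomputable def tensorGrad (p : ℝ → ℝ) (u : E d → ℝ) (g : E d → E d) : E (d + 1) → E (d + 1) :=
  fun x => vtensor (deriv p) (fun y => u y • axis d) x + vtensor p (fun y => crossEmb d (g y)) x

lemma tensorGrad_apply (p : ℝ → ℝ) (u : E d → ℝ) (g : E d → E d) (x : E (d + 1)) :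
    tensorGrad p u g x = (deriv p (x 0) * u (crossPart x)) • axis d +
      crossEmb d (p (x 0) • g (crossPart x)) := by
  simp [tensorGrad, vtensor, smul_smul]

/-- The x₁ direction and the cross-section directions are orthogonal, so no mixed terms appear. This
is what lets the Dirichlet form separate variables. -/
lemma inner_tensorGrad (p q : ℝ → ℝ) (u v : E d → ℝ) (g h : E d → E d) (x : E (d + 1)) :
    inner ℝ (tensorGrad p u g x) (tensorGrad q v h x) =
      (deriv p (x 0) * deriv q (x 0)) * (u (crossPart x) * v (crossPart x)) +
        (p (x 0) * q (x 0)) * inner ℝ (g (crossPart x)) (h (crossPart x)) := by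
  rw [inner_split, tensorGrad_apply, tensorGrad_apply]
  have : ∀ (a : ℝ) (v : E d), crossPart (a • axis d + crossEmb d v) = v := by
    intro a v; ext i; simp
  rw [this, this]
  simp [inner_smul_left, inner_smul_right]
  ring

lemma gradient_tensor {p : ℝ → ℝ} {u : E d → ℝ} (hp : Differentiable ℝ p)
    (hu : Differentiable ℝ u) : gradient (tensor p u) = tensorGrad p u (gradient u) := by
  ext1 x
  have h0 : HasFDerivAt (fun x : E (d + 1) => x 0) (EuclideanSpace.proj 0 : E (d + 1) →L[ℝ] ℝ) x :=
    (EuclideanSpace.proj 0 : E (d + 1) →L[ℝ] ℝ).hasFDerivAt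
  have h1 := (hp (x 0)).hasDerivAt.comp_hasFDerivAt x h0
  have h2 : HasFDerivAt (fun x : E (d + 1) => u (crossPart x))
      ((fderiv ℝ u (crossPart x)).comp (crossProj d)) x :=
    (hu (crossPart x)).hasFDerivAt.comp x (crossProj d).hasFDerivAt
  have h3 := h1.fun_mul h2
  refine ext_inner_right ℝ fun v => ?_
  rw [inner_gradient_left]
  have h4 : fderiv ℝ (tensor p u) x = _ := h3.fderiv
  rw [h4, inner_split, tensorGrad_apply]
  have : ∀ (a : ℝ) (v : E d), crossPart (a • axis d + crossEmb d v) = v := by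
    intro a v; ext i; simp
  rw [this, real_inner_smul_left, inner_gradient_left]
  simp [crossProj_apply]
  ring

end

/-! ### One-dimensional profiles, and tensor products in H¹₀ of the cylinder. -/

section

variable {d : ℕ} {S : Set (E d)} {ℓ : ℝ}

/-- `φ ∈ C_c^∞(-ℓ, ℓ)`. -/
def IsTestProfile (ℓ : ℝ) (φ : ℝ → ℝ) : Prop :=
  ContDiff ℝ ((⊤ : ℕ∞) : WithTop ℕ∞) φ ∧ HasCompactSupport φ ∧ tsupport φ ⊆ Set.Ioo (-ℓ) ℓ

/-- `ψ` is smooth and its restriction to `(-ℓ, ℓ)` belongs to `H¹₀(-ℓ, ℓ)`. -/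
structure IsProfile (ℓ : ℝ) (ψ : ℝ → ℝ) : Prop where
  contDiff : ContDiff ℝ ((⊤ : ℕ∞) : WithTop ℕ∞) ψ
  exists_tendsto : ∃ φ : ℕ → ℝ → ℝ, (∀ k, IsTestProfile ℓ (φ k)) ∧
    Tendsto (fun k => eLpNorm (fun t => ψ t - φ k t) 2 (volume.restrict (Set.Ioo (-ℓ) ℓ)))
      atTop (𝓝 0) ∧
    Tendsto (fun k => eLpNorm (fun t => deriv ψ t - deriv (φ k) t) 2
      (volume.restrict (Set.Ioo (-ℓ) ℓ))) atTop (𝓝 0)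

lemma IsTestProfile.isProfile {φ : ℝ → ℝ} (h : IsTestProfile ℓ φ) : IsProfile ℓ φ :=
  ⟨h.1, fun _ => φ, fun _ => h, by simp, by simp⟩

lemma memLp_Ioo_of_continuous {p : ℝ → ℝ} (hp : Continuous p) (s : ℝ) :
    MemLp p 2 (volume.restrict (Set.Ioo (-s) s)) := by
  obtain ⟨C, hC⟩ := (isCompact_Icc (a := -s) (b := s)).exists_bound_of_continuousOn hp.continuousOn
  refine MemLp.of_bound hp.aestronglyMeasurable C ?_
  filter_upwards [ae_restrict_mem measurableSet_Ioo] with t ht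
  exact hC t (Set.Ioo_subset_Icc_self ht)

lemma continuous_deriv_of_contDiff {p : ℝ → ℝ}
    (hp : ContDiff ℝ ((⊤ : ℕ∞) : WithTop ℕ∞) p) : Continuous (deriv p) :=
  hp.continuous_deriv (by simp)

lemma memLp_smul_const {X F : Type*} [MeasurableSpace X] [NormedAddCommGroup F] [NormedSpace ℝ F]
    {μ : Measure X} {w : X → ℝ} (hw : MemLp w 2 μ) (v : F) : MemLp (fun x => w x • v) 2 μ :=
  (ContinuousLinearMap.toSpanSingleton ℝ v).comp_memLp' hw

lemma memLp_tensorGrad (hS : MeasurableSet S) {p : ℝ → ℝ}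
    (hp : ContDiff ℝ ((⊤ : ℕ∞) : WithTop ℕ∞) p) {u : E d → ℝ} {g : E d → E d}
    (hu : MemLp u 2 (volume.restrict S)) (hg : MemLp g 2 (volume.restrict S)) (s : ℝ) :
    MemLp (tensorGrad p u g) 2 (volume.restrict (longDomain S s)) :=
  (memLp_vtensor hS (memLp_Ioo_of_continuous (continuous_deriv_of_contDiff hp) s)
    (memLp_smul_const hu (axis d))).add
  (memLp_vtensor hS (memLp_Ioo_of_continuous hp.continuous s)
    ((crossEmb d).comp_memLp' hg))

lemma IsTestFunction.tensor {φ : ℝ → ℝ} {χ : E d → ℝ} (hφ : IsTestProfile ℓ φ)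
    (hχ : IsTestFunction S χ) : IsTestFunction (longDomain S ℓ) (tensor φ χ) := by
  -- The image of the product of the supports: a compact set containing the support of φ ⊗ χ.
  set K : Set (E (d + 1)) :=
    (fun z : ℝ × E d => z.1 • axis d + crossEmb d z.2) '' (tsupport φ ×ˢ tsupport χ) with hK
  have hKc : IsCompact K := by
    refine (hφ.2.1.prod hχ.2.1).image ?_
    fun_prop
  have h0 : ∀ x, x ∉ K → LongDomain.tensor φ χ x = 0 := by
    intro x hx
    by_contra hne
    refine hx ⟨(x 0, crossPart x), ⟨?_, ?_⟩, split_eq x⟩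
    · exact subset_tsupport _ (left_ne_zero_of_mul hne)
    · exact subset_tsupport _ (right_ne_zero_of_mul hne)
  refine ⟨?_, HasCompactSupport.intro hKc h0, ?_⟩
  · refine ContDiff.mul (hφ.1.comp ?_) (hχ.1.comp (crossProj d).contDiff)
    exact (EuclideanSpace.proj 0 : E (d + 1) →L[ℝ] ℝ).contDiff
  · have hsub : tsupport (LongDomain.tensor φ χ) ⊆ K :=
      closure_minimal (fun x hx => by_contra fun hx' => hx (h0 x hx')) hKc.isClosed
    refine hsub.trans ?_
    rintro x ⟨⟨t, y⟩, ⟨ht, hy⟩, rfl⟩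
    have h1 : crossPart (t • axis d + crossEmb d y) = y := by ext i; simp
    exact ⟨by simpa using hφ.2.2 ht, by rw [h1]; exact hχ.2.2 hy⟩

/-- Approximating sequences for the profile and for `u` are multiplied. Both parts of the gradient,
p' ⊗ u and p ⊗ ∇'u, then converge as tensor products. -/
lemma H10Pair.tensor (hS : MeasurableSet S) {ψ : ℝ → ℝ} (hψ : IsProfile ℓ ψ) {u : E d → ℝ}
    {g : E d → E d} (h : H10Pair S u g) :
    H10Pair (longDomain S ℓ) (LongDomain.tensor ψ u) (tensorGrad ψ u g) := by
  obtain ⟨φ, hφ, a1, a2⟩ := hψ.exists_tendsto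
  obtain ⟨χ, hχ, b1, b2⟩ := h.exists_tendsto
  have c0 : ∀ {p : ℝ → ℝ}, ContDiff ℝ ((⊤ : ℕ∞) : WithTop ℕ∞) p →
      MemLp p 2 (volume.restrict (Set.Ioo (-ℓ) ℓ)) :=
    fun hp => memLp_Ioo_of_continuous hp.continuous ℓ
  have c1 : ∀ {p : ℝ → ℝ}, ContDiff ℝ ((⊤ : ℕ∞) : WithTop ℕ∞) p →
      MemLp (deriv p) 2 (volume.restrict (Set.Ioo (-ℓ) ℓ)) :=
    fun hp => memLp_Ioo_of_continuous (continuous_deriv_of_contDiff hp) ℓ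
  refine ⟨memLp_vtensor hS (c0 hψ.contDiff) h.memLp,
    memLp_tensorGrad hS hψ.contDiff h.memLp h.memLp_grad ℓ,
    fun k => LongDomain.tensor (φ k) (χ k), fun k => IsTestFunction.tensor (hφ k) (hχ k), ?_, ?_⟩
  · exact tendsto_eLpNorm_vtensor_sub hS (c0 hψ.contDiff) h.memLp (fun k => c0 (hφ k).1)
      (fun k => (hχ k).memLp) a1 b1
  · have ax : ∀ {w : E d → ℝ}, MemLp w 2 (volume.restrict S) →
        MemLp (fun y => w y • axis d) 2 (volume.restrict S) :=
      fun hw => memLp_smul_const hw (axis d)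
    have em : ∀ {w : E d → E d}, MemLp w 2 (volume.restrict S) →
        MemLp (fun y => crossEmb d (w y)) 2 (volume.restrict S) :=
      fun hw => (crossEmb d).comp_memLp' hw
    have b1' : Tendsto (fun k => eLpNorm (fun y => u y • axis d - χ k y • axis d) 2
        (volume.restrict S)) atTop (𝓝 0) := by
      refine b1.congr fun k => eLpNorm_congr_norm_ae (Eventually.of_forall fun y => ?_)
      rw [← sub_smul, norm_smul, norm_axis, mul_one]
    have b2' : Tendsto (fun k => eLpNorm
        (fun y => crossEmb d (g y) - crossEmb d (gradient (χ k) y)) 2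
        (volume.restrict S)) atTop (𝓝 0) := by
      refine b2.congr fun k => eLpNorm_congr_norm_ae (Eventually.of_forall fun y => ?_)
      rw [← map_sub, norm_crossEmb]
    have t1 := tendsto_eLpNorm_vtensor_sub hS (c1 hψ.contDiff) (ax h.memLp)
      (fun k => c1 (hφ k).1) (fun k => ax (hχ k).memLp) a2 b1'
    have t2 := tendsto_eLpNorm_vtensor_sub hS (c0 hψ.contDiff) (em h.memLp_grad)
      (fun k => c0 (hφ k).1) (fun k => em (hχ k).memLp_gradient) a1 b2'
    refine (tendsto_eLpNorm_add (fun k => ?_) (fun k => ?_) t1 t2).congr fun k => ?_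
    · exact ((memLp_vtensor hS (c1 hψ.contDiff) (ax h.memLp)).sub
        (memLp_vtensor hS (c1 (hφ k).1) (ax (hχ k).memLp))).1
    · exact ((memLp_vtensor hS (c0 hψ.contDiff) (em h.memLp_grad)).sub
        (memLp_vtensor hS (c0 (hφ k).1) (em (hχ k).memLp_gradient))).1
    · congr 1
      ext1 x
      rw [gradient_tensor ((hφ k).1.differentiable (by simp)) (hχ k).differentiable]
      simp only [tensorGrad, Pi.add_apply]
      abel

end

/-! ### The profiles ψ_ℓ(a, ·): membership in H¹₀(-ℓ, ℓ), equation and energy. -/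

section

variable {ℓ : ℝ}

lemma tendsto_eLpNorm_zero_of_bounded {X : Type*} [MeasurableSpace X] {μ : Measure X}
    [IsFiniteMeasure μ] {f : ℕ → X → ℝ} (C : ℝ) (hm : ∀ k, AEStronglyMeasurable (f k) μ)
    (hb : ∀ k, ∀ᵐ x ∂μ, ‖f k x‖ ≤ C) (hlim : ∀ᵐ x ∂μ, Tendsto (fun k => f k x) atTop (𝓝 0)) :
    Tendsto (fun k => eLpNorm (f k) 2 μ) atTop (𝓝 0) := by
  have h : Tendsto (fun k => ∫⁻ x, ‖f k x‖ₑ ^ (2 : ℝ) ∂μ) atTop (𝓝 (∫⁻ _, 0 ∂μ)) := by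
    refine tendsto_lintegral_of_dominated_convergence' (fun _ => ENNReal.ofReal C ^ (2 : ℝ))
      (fun k => (hm k).enorm.pow_const _) (fun k => ?_) ?_ ?_
    · filter_upwards [hb k] with x hx
      gcongr
      rw [← ofReal_norm]
      exact ENNReal.ofReal_le_ofReal hx
    · rw [lintegral_const]
      exact ENNReal.mul_ne_top (by simp) (measure_ne_top _ _)
    · filter_upwards [hlim] with x hx
      have := (hx.enorm).ennrpow_const (2 : ℝ)
      simpa using this
  simp only [eLpNorm_two_eq]
  have := h.ennrpow_const (1 / 2 : ℝ)
  simpa using this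

/-- A smooth function that is positive exactly on `(-ℓ, ℓ)` belongs to `H¹₀(-ℓ, ℓ)`. -/
lemma isProfile_of_pos {ψ : ℝ → ℝ} (hψ : ContDiff ℝ ((⊤ : ℕ∞) : WithTop ℕ∞) ψ)
    (hpos : ∀ t, 0 < ψ t ↔ t ∈ Set.Ioo (-ℓ) ℓ) : IsProfile ℓ ψ := by
  set σ : ℝ → ℝ := Real.smoothTransition with hσ
  have σone : ∀ y, 1 ≤ y → σ y = 1 := fun y => Real.smoothTransition.one_of_one_le
  have σzero : ∀ y, y ≤ 0 → σ y = 0 := fun y => Real.smoothTransition.zero_of_nonpos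
  have hσc : ContDiff ℝ ((⊤ : ℕ∞) : WithTop ℕ∞) σ := Real.smoothTransition.contDiff
  have hσd : ∀ y, HasDerivAt σ (deriv σ y) y :=
    fun y => (hσc.differentiable (by simp) y).hasDerivAt
  have hσ1 : ∀ y, 1 < y → deriv σ y = 0 := by
    intro y hy
    have : σ =ᶠ[𝓝 y] fun _ => (1 : ℝ) := by
      filter_upwards [lt_mem_nhds hy] with z hz
      exact Real.smoothTransition.one_of_one_le hz.le
    rw [this.deriv_eq]; simp
  -- By the chain rule φₖ' = ψ' · M((k+1)ψ) for the truncations φₖ below. Since M is continuous and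
  -- equals 1 beyond 2, it is bounded on [0, ∞), so φₖ' is bounded uniformly in k on (-ℓ, ℓ) even
  -- though the cutoff steepens.
  set M : ℝ → ℝ := fun y => σ (y - 1) + y * deriv σ (y - 1) with hM
  have hMc : Continuous M := by
    have h1 := hσc.continuous
    have h2 := continuous_deriv_of_contDiff hσc
    fun_prop
  have hM2 : ∀ y, 2 < y → M y = 1 := by
    intro y hy
    simp only [hM]
    rw [hσ1 _ (by linarith), σone _ (by linarith)]; simp
  obtain ⟨C, hC⟩ := (isCompact_Icc (a := (0 : ℝ)) (b := 2)).exists_bound_of_continuousOn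
    hMc.continuousOn
  have hMb : ∀ y, 0 ≤ y → ‖M y‖ ≤ max C 1 := by
    intro y hy
    rcases le_or_gt y 2 with h | h
    · exact (hC y ⟨hy, h⟩).trans (le_max_left _ _)
    · rw [hM2 y h]; simp
  -- Truncation by the level of ψ itself: φₖ vanishes where ψ ≤ 1/(k+1) and equals ψ where ψ ≥
  -- 2/(k+1).
  set φ : ℕ → ℝ → ℝ := fun k t => ψ t * σ ((k + 1) * ψ t - 1) with hφ
  have hψd : ∀ t, HasDerivAt ψ (deriv ψ t) t := fun t => (hψ.differentiable (by simp) t).hasDerivAt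
  have hφd : ∀ k t, deriv (φ k) t = deriv ψ t * M ((k + 1) * ψ t) := by
    intro k t
    have h1 : HasDerivAt (fun t => (k + 1 : ℝ) * ψ t - 1) ((k + 1) * deriv ψ t) t :=
      ((hψd t).const_mul _).sub_const _
    have h2 := (hψd t).fun_mul ((hσd ((k + 1) * ψ t - 1)).comp t h1)
    have h3 : deriv (φ k) t = _ := h2.deriv
    rw [h3]
    simp only [hM, Function.comp_apply]
    ring
  have hφc : ∀ k, ContDiff ℝ ((⊤ : ℕ∞) : WithTop ℕ∞) (φ k) := by
    intro k
    exact hψ.mul (hσc.comp ((contDiff_const.mul hψ).sub contDiff_const))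
  have hφs : ∀ k, tsupport (φ k) ⊆ Set.Ioo (-ℓ) ℓ := by
    intro k
    have hcl : IsClosed {t | 1 ≤ (k + 1 : ℝ) * ψ t} :=
      isClosed_le continuous_const (continuous_const.mul hψ.continuous)
    refine (closure_minimal (fun t ht => ?_) hcl).trans fun t ht => ?_
    · by_contra hlt
      refine ht ?_
      simp only [hφ]
      rw [σzero _ (by simp at hlt; linarith), mul_zero]
    · rw [← hpos]
      have : 0 < (k + 1 : ℝ) * ψ t := lt_of_lt_of_le one_pos ht
      exact (pos_iff_pos_of_mul_pos this).1 (by positivity)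
  have hfar : ∀ t ∈ Set.Ioo (-ℓ) ℓ, ∀ᶠ k : ℕ in atTop, 2 < (k + 1 : ℝ) * ψ t := by
    intro t ht
    have h1 := (hpos t).2 ht
    have h2 : Tendsto (fun k : ℕ => (k + 1 : ℝ) * ψ t) atTop atTop :=
      (tendsto_atTop_add_const_right _ _ tendsto_natCast_atTop_atTop).atTop_mul_const h1
    exact h2.eventually_gt_atTop 2
  refine ⟨hψ, φ, fun k => ⟨hφc k, ?_, hφs k⟩, ?_, ?_⟩
  · exact Metric.isCompact_of_isClosed_isBounded (isClosed_tsupport _)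
      (Metric.isBounded_Ioo (-ℓ) ℓ |>.subset (hφs k))
  · obtain ⟨B, hB⟩ := (isCompact_Icc (a := -ℓ) (b := ℓ)).exists_bound_of_continuousOn
      hψ.continuous.continuousOn
    refine tendsto_eLpNorm_zero_of_bounded B
      (fun k => (hψ.continuous.sub (hφc k).continuous).aestronglyMeasurable) (fun k => ?_) ?_
    · filter_upwards [ae_restrict_mem measurableSet_Ioo] with t ht
      refine le_trans ?_ (hB t (Set.Ioo_subset_Icc_self ht))
      have h1 := Real.smoothTransition.nonneg ((k + 1) * ψ t - 1)
      have h2 := Real.smoothTransition.le_one ((k + 1) * ψ t - 1)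
      have : ψ t - φ k t = ψ t * (1 - σ ((k + 1) * ψ t - 1)) := by simp only [hφ]; ring
      rw [this, norm_mul]
      refine mul_le_of_le_one_right (norm_nonneg _) ?_
      rw [Real.norm_eq_abs, abs_le]; constructor <;> linarith
    · filter_upwards [ae_restrict_mem measurableSet_Ioo] with t ht
      refine tendsto_const_nhds.congr' ?_
      filter_upwards [hfar t ht] with k hk
      simp only [hφ]
      rw [σone _ (by linarith)]; simp
  · obtain ⟨B, hB⟩ := (isCompact_Icc (a := -ℓ) (b := ℓ)).exists_bound_of_continuousOn
      (continuous_deriv_of_contDiff hψ).continuousOn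
    refine tendsto_eLpNorm_zero_of_bounded (B * (1 + max C 1))
      (fun k => ((continuous_deriv_of_contDiff hψ).sub
        (continuous_deriv_of_contDiff (hφc k))).aestronglyMeasurable) (fun k => ?_) ?_
    · filter_upwards [ae_restrict_mem measurableSet_Ioo] with t ht
      have h1 := hB t (Set.Ioo_subset_Icc_self ht)
      have h2 := hMb ((k + 1) * ψ t) (mul_nonneg (by positivity) ((hpos t).2 ht).le)
      rw [hφd, ← mul_one_sub, norm_mul]
      gcongr
      · exact (norm_nonneg _).trans h1
      · refine (norm_sub_le _ _).trans ?_
        simpa using h2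
    · filter_upwards [ae_restrict_mem measurableSet_Ioo] with t ht
      refine tendsto_const_nhds.congr' ?_
      filter_upwards [hfar t ht] with k hk
      rw [hφd, hM2 _ hk]; simp

lemma contDiff_psi (ℓ a : ℝ) : ContDiff ℝ ((⊤ : ℕ∞) : WithTop ℕ∞) (psi ℓ a) := by
  unfold psi
  exact contDiff_const.sub ((Real.contDiff_cosh.comp (contDiff_const.mul contDiff_id)).div_const _)

lemma isProfile_psi (hℓ : 0 < ℓ) {a : ℝ} (ha : 0 ≤ a) : IsProfile ℓ (psi ℓ a) := by
  rcases ha.eq_or_lt with rfl | ha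
  -- For a = 0 the profile vanishes identically, so the positivity criterion fails, but 0 is itself
  -- a test profile.
  · have : psi ℓ 0 = 0 := by ext t; simp [psi]
    rw [this]
    have ht : IsTestProfile ℓ 0 :=
      ⟨contDiff_zero_fun, HasCompactSupport.zero, by simp [tsupport]⟩
    exact ht.isProfile
  · refine isProfile_of_pos (contDiff_psi ℓ a) fun t => ?_
    rw [psi, sub_pos, div_lt_one (Real.cosh_pos _), Real.cosh_lt_cosh, abs_mul, abs_mul,
      mul_lt_mul_iff_right₀ (abs_pos.2 ha.ne'), abs_of_pos hℓ, abs_lt, Set.mem_Ioo]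

lemma hasDerivAt_psi (ℓ a t : ℝ) :
    HasDerivAt (psi ℓ a) (-(a * Real.sinh (a * t) / Real.cosh (a * ℓ))) t := by
  have h1 : HasDerivAt (fun t : ℝ => a * t) a t := by simpa using (hasDerivAt_id t).const_mul a
  have h2 := ((h1.cosh).div_const (Real.cosh (a * ℓ))).const_sub 1
  refine h2.congr_deriv ?_
  ring

lemma deriv_psi (ℓ a : ℝ) :
    deriv (psi ℓ a) = fun t => -(a * Real.sinh (a * t) / Real.cosh (a * ℓ)) :=
  funext fun t => (hasDerivAt_psi ℓ a t).deriv

lemma hasDerivAt_deriv_psi (ℓ a t : ℝ) :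
    HasDerivAt (deriv (psi ℓ a)) (a ^ 2 * (psi ℓ a t - 1)) t := by
  rw [deriv_psi]
  have h1 : HasDerivAt (fun t : ℝ => a * t) a t := by simpa using (hasDerivAt_id t).const_mul a
  have h2 := (((h1.sinh).const_mul a).div_const (Real.cosh (a * ℓ))).neg
  refine h2.congr_deriv ?_
  simp only [psi]
  ring

lemma setIntegral_Ioo_eq (s : ℝ) (hs : 0 ≤ s) (f : ℝ → ℝ) :
    ∫ t in Set.Ioo (-s) s, f t = ∫ t in (-s)..s, f t := by
  rw [intervalIntegral.integral_of_le (by linarith), integral_Ioc_eq_integral_Ioo]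

/-- The equation `-ψ'' + a² ψ = a²` for `ψ = ψ_ℓ(a, ·)`, tested against `p`. -/
lemma integral_psi_mul (hℓ : 0 < ℓ) (a : ℝ) {p : ℝ → ℝ}
    (hp : ContDiff ℝ ((⊤ : ℕ∞) : WithTop ℕ∞) p) (h1 : p (-ℓ) = 0) (h2 : p ℓ = 0) :
    (∫ t in Set.Ioo (-ℓ) ℓ, deriv (psi ℓ a) t * deriv p t) +
      a ^ 2 * ∫ t in Set.Ioo (-ℓ) ℓ, psi ℓ a t * p t = a ^ 2 * ∫ t in Set.Ioo (-ℓ) ℓ, p t := by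
  simp only [setIntegral_Ioo_eq ℓ hℓ.le]
  have hc := (contDiff_psi ℓ a).continuous
  have hpc := hp.continuous
  have hpd := continuous_deriv_of_contDiff hp
  rw [intervalIntegral.integral_mul_deriv_eq_deriv_mul
    (fun t _ => hasDerivAt_deriv_psi ℓ a t)
    (fun t _ => (hp.differentiable (by simp) t).hasDerivAt)
    ((by fun_prop : Continuous fun t => a ^ 2 * (psi ℓ a t - 1)).intervalIntegrable _ _)
    (hpd.intervalIntegrable _ _), h1, h2, ← intervalIntegral.integral_const_mul,
    ← intervalIntegral.integral_const_mul]
  have i1 : IntervalIntegrable (fun t => a ^ 2 * (psi ℓ a t * p t)) volume (-ℓ) ℓ :=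
    (by fun_prop : Continuous fun t => a ^ 2 * (psi ℓ a t * p t)).intervalIntegrable _ _
  have i2 : IntervalIntegrable (fun t => a ^ 2 * p t) volume (-ℓ) ℓ :=
    (by fun_prop : Continuous fun t => a ^ 2 * p t).intervalIntegrable _ _
  have : ∫ t in (-ℓ)..ℓ, a ^ 2 * (psi ℓ a t - 1) * p t =
      (∫ t in (-ℓ)..ℓ, a ^ 2 * (psi ℓ a t * p t)) - ∫ t in (-ℓ)..ℓ, a ^ 2 * p t := by
    rw [← intervalIntegral.integral_sub i1 i2]
    congr 1; ext t; ring
  rw [this]; ring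

/-- The energy of `cosh (a t) / cosh (a ℓ)` on `(-s, s)` with `s = ℓ - δ`. -/
lemma integral_cosh_energy_le {a δ : ℝ} (ha : 0 ≤ a) (hδ : δ < ℓ) :
    (∫ t in Set.Ioo (-(ℓ - δ)) (ℓ - δ), deriv (psi ℓ a) t ^ 2) +
      a ^ 2 * ∫ t in Set.Ioo (-(ℓ - δ)) (ℓ - δ), (1 - psi ℓ a t) ^ 2 ≤
      2 * a * Real.exp (-2 * a * δ) := by
  set s := ℓ - δ with hs
  have hs0 : 0 ≤ s := by linarith
  have hc := (contDiff_psi ℓ a).continuous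
  have hcd := continuous_deriv_of_contDiff (contDiff_psi ℓ a)
  simp only [setIntegral_Ioo_eq s hs0]
  rw [← intervalIntegral.integral_const_mul, ← intervalIntegral.integral_add
    ((by fun_prop : Continuous fun t => deriv (psi ℓ a) t ^ 2).intervalIntegrable _ _)
    ((by fun_prop : Continuous fun t => a ^ 2 * (1 - psi ℓ a t) ^ 2).intervalIntegrable _ _)]
  -- With w = cosh(at)/cosh(aℓ), the equation w'' = a²w gives w'² + a²w² = (w w')', so the energy is
  -- a boundary term.
  have hder : ∀ t, HasDerivAt (fun t => a * Real.sinh (a * t) * Real.cosh (a * t) /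
      Real.cosh (a * ℓ) ^ 2) (deriv (psi ℓ a) t ^ 2 + a ^ 2 * (1 - psi ℓ a t) ^ 2) t := by
    intro t
    have h1 : HasDerivAt (fun t : ℝ => a * t) a t := by simpa using (hasDerivAt_id t).const_mul a
    have h2 := (((h1.sinh).const_mul a).fun_mul h1.cosh).div_const (Real.cosh (a * ℓ) ^ 2)
    refine h2.congr_deriv ?_
    rw [deriv_psi, psi]
    have := (Real.cosh_pos (a * ℓ)).ne'
    field_simp
    ring
  rw [intervalIntegral.integral_eq_sub_of_hasDerivAt (fun t _ => hder t)
    ((by fun_prop : Continuous fun t => deriv (psi ℓ a) t ^ 2 +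
      a ^ 2 * (1 - psi ℓ a t) ^ 2).intervalIntegrable _ _)]
  have e : a * Real.sinh (a * s) * Real.cosh (a * s) / Real.cosh (a * ℓ) ^ 2 -
      a * Real.sinh (a * -s) * Real.cosh (a * -s) / Real.cosh (a * ℓ) ^ 2 =
      a * (2 * Real.sinh (a * s) * Real.cosh (a * s)) / Real.cosh (a * ℓ) ^ 2 := by
    rw [mul_neg, Real.sinh_neg, Real.cosh_neg]; ring
  rw [e, ← Real.sinh_two_mul, div_le_iff₀ (pow_pos (Real.cosh_pos _) 2)]
  have b1 : Real.sinh (2 * (a * s)) ≤ Real.exp (2 * (a * s)) / 2 := by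
    rw [Real.sinh_eq]; have := Real.exp_pos (-(2 * (a * s))); linarith
  have b2 : Real.exp (a * ℓ) / 2 ≤ Real.cosh (a * ℓ) := by
    rw [Real.cosh_eq]; have := Real.exp_pos (-(a * ℓ)); linarith
  have b3 : (Real.exp (a * ℓ) / 2) ^ 2 ≤ Real.cosh (a * ℓ) ^ 2 := by gcongr
  -- The factor e^{-2aδ} is the ratio of e^{2a(ℓ-δ)}, from sinh, to e^{2aℓ}, from cosh².
  calc a * Real.sinh (2 * (a * s)) ≤ a * (Real.exp (2 * (a * s)) / 2) := by gcongr
    _ = 2 * a * Real.exp (-2 * a * δ) * (Real.exp (a * ℓ) / 2) ^ 2 := by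
      have : Real.exp (2 * (a * s)) = Real.exp (-2 * a * δ) * Real.exp (a * ℓ) ^ 2 := by
        rw [← Real.exp_nat_mul, ← Real.exp_add, hs]
        congr 1; push_cast; ring
      rw [this]; ring
    _ ≤ _ := by gcongr

/-- The profiles `ψ_ℓ(a, ·)` and their derivatives are ordered consistently, so that the square of
a difference is at most the sum of the squares of the `cosh` parts. -/
lemma integral_sq_psi_sub_le {a b : ℝ} (ha : 0 ≤ a) (hb : 0 ≤ b) (s : ℝ) :
    (∫ t in Set.Ioo (-s) s, deriv (fun t => psi ℓ a t - psi ℓ b t) t ^ 2 ≤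
      (∫ t in Set.Ioo (-s) s, deriv (psi ℓ a) t ^ 2) +
        ∫ t in Set.Ioo (-s) s, deriv (psi ℓ b) t ^ 2) ∧
    (∫ t in Set.Ioo (-s) s, (psi ℓ a t - psi ℓ b t) ^ 2 ≤
      (∫ t in Set.Ioo (-s) s, (1 - psi ℓ a t) ^ 2) +
        ∫ t in Set.Ioo (-s) s, (1 - psi ℓ b t) ^ 2) := by
  have hint : ∀ {f : ℝ → ℝ}, Continuous f → Integrable f (volume.restrict (Set.Ioo (-s) s)) :=
    fun hf => (hf.integrableOn_Icc).mono_set Set.Ioo_subset_Icc_self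
  have hc := fun a => (contDiff_psi ℓ a).continuous
  have hcd := fun a => continuous_deriv_of_contDiff (contDiff_psi ℓ a)
  have hca := hc a
  have hcb := hc b
  have hda := hcd a
  have hdb := hcd b
  have hd : deriv (fun t => psi ℓ a t - psi ℓ b t) =
      fun t => deriv (psi ℓ a) t - deriv (psi ℓ b) t := by
    ext t
    rw [deriv_fun_sub (hasDerivAt_psi ℓ a t).differentiableAt
      (hasDerivAt_psi ℓ b t).differentiableAt]
  constructor
  · rw [hd, ← integral_add (hint (by fun_prop)) (hint (by fun_prop))]
    refine integral_mono (hint (by fun_prop)) (hint (by fun_prop)) fun t => ?_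
    -- Both sinh(at) and sinh(bt) have the sign of t, so the cross term can be dropped when the
    -- square is expanded.
    have : 0 ≤ deriv (psi ℓ a) t * deriv (psi ℓ b) t := by
      simp only [deriv_psi, neg_mul_neg]
      rw [div_mul_div_comm]
      refine div_nonneg ?_ (by positivity)
      rcases le_total 0 t with ht | ht
      · have h1 : 0 ≤ Real.sinh (a * t) := Real.sinh_nonneg_iff.2 (by positivity)
        have h2 : 0 ≤ Real.sinh (b * t) := Real.sinh_nonneg_iff.2 (by positivity)
        positivity
      · have h1 : Real.sinh (a * t) ≤ 0 :=
          Real.sinh_nonpos_iff.2 (mul_nonpos_of_nonneg_of_nonpos ha ht)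
        have h2 : Real.sinh (b * t) ≤ 0 :=
          Real.sinh_nonpos_iff.2 (mul_nonpos_of_nonneg_of_nonpos hb ht)
        exact mul_nonneg_of_nonpos_of_nonpos (mul_nonpos_of_nonneg_of_nonpos ha h1)
          (mul_nonpos_of_nonneg_of_nonpos hb h2)
    simp only
    nlinarith
  · rw [← integral_add (hint (by fun_prop)) (hint (by fun_prop))]
    refine integral_mono (hint (by fun_prop)) (hint (by fun_prop)) fun t => ?_
    have : 0 ≤ (1 - psi ℓ a t) * (1 - psi ℓ b t) := by
      simp only [psi, sub_sub_cancel]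
      positivity
    simp only
    nlinarith

end

/-! ### Density of tensor products among the gradients of test functions. -/

section

variable {d : ℕ} {S : Set (E d)} {ℓ : ℝ}

lemma volume_longDomain_ne_top (hS : MeasurableSet S) (hfin : volume S ≠ ⊤) (s : ℝ) :
    volume (longDomain S s) ≠ ⊤ := by
  have h := (measurePreserving_split_longDomain hS s).measure_preimage
    (s := Set.univ) MeasurableSet.univ.nullMeasurableSet
  have h2 : volume (longDomain S s) = boxMeasure S s Set.univ := by simpa using h
  rw [h2, boxMeasure, ← Set.univ_prod_univ, Measure.prod_prod]
  simpa using ENNReal.mul_ne_top (by simp) hfin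

lemma isOpen_longDomain (hS : IsOpen S) (s : ℝ) : IsOpen (longDomain S s) := by
  have h0 : Continuous fun x : E (d + 1) => x 0 :=
    (EuclideanSpace.proj 0 : E (d + 1) →L[ℝ] ℝ).continuous
  exact (isOpen_Ioo.preimage h0).inter (hS.preimage continuous_crossPart)

/-- The point `(s, y)`. -/
noncomputable def joinPt (s : ℝ) (y : E d) : E (d + 1) := s • axis d + crossEmb d y

lemma continuous_joinPt : Continuous fun z : ℝ × E d => joinPt z.1 z.2 := by
  unfold joinPt; fun_prop

@[simp] lemma joinPt_zero_coord (s : ℝ) (y : E d) : joinPt s y 0 = s := by simp [joinPt]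
@[simp] lemma crossPart_joinPt (s : ℝ) (y : E d) : crossPart (joinPt s y) = y := by
  ext i; simp [joinPt]
@[simp] lemma joinPt_split (x : E (d + 1)) : joinPt (x 0) (crossPart x) = x := split_eq x

lemma hasFDerivAt_joinPt_right (s : ℝ) (y : E d) :
    HasFDerivAt (fun y => joinPt s y) (crossEmb d) y :=
  (crossEmb d).hasFDerivAt.const_add _

lemma hasDerivAt_joinPt_left (s : ℝ) (y : E d) :
    HasDerivAt (fun s => joinPt s y) (axis d) s := by
  have h := ((hasDerivAt_id s).smul_const (axis d)).add_const (crossEmb d y)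
  rw [one_smul] at h
  exact h

section slice
variable {ζ : E (d + 1) → ℝ}

/-- The support of a slice lies in the projection of the support of ζ, a compact subset of `S`. -/
lemma IsTestFunction.slice (hζ : IsTestFunction (longDomain S ℓ) ζ) (s : ℝ) :
    IsTestFunction S fun y => ζ (joinPt s y) := by
  have hK : IsCompact (crossPart '' tsupport ζ) := hζ.2.1.image continuous_crossPart
  have h0 : ∀ y, y ∉ crossPart '' tsupport ζ → ζ (joinPt s y) = 0 := by
    intro y hy
    by_contra hne
    exact hy ⟨joinPt s y, subset_tsupport _ hne, by simp⟩
  refine ⟨hζ.1.comp (contDiff_const.add (crossEmb d).contDiff), HasCompactSupport.intro hK h0, ?_⟩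
  have hsub : tsupport (fun y => ζ (joinPt s y)) ⊆ crossPart '' tsupport ζ :=
    closure_minimal (fun x hx => by_contra fun hx' => hx (h0 x hx')) hK.isClosed
  refine hsub.trans ?_
  rintro _ ⟨x, hx, rfl⟩
  exact (hζ.2.2 hx).2

lemma IsTestFunction.gradient_slice (hζ : IsTestFunction (longDomain S ℓ) ζ) (s : ℝ) (y : E d) :
    gradient (fun y => ζ (joinPt s y)) y = crossPart (gradient ζ (joinPt s y)) := by
  refine ext_inner_right ℝ fun v => ?_
  rw [inner_gradient_left]
  have h := (hζ.differentiable (joinPt s y)).hasFDerivAt.comp y (hasFDerivAt_joinPt_right s y)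
  have h2 : fderiv ℝ (fun y => ζ (joinPt s y)) y = _ := h.fderiv
  rw [h2, ContinuousLinearMap.comp_apply, ← inner_gradient_left, inner_split]
  simp

lemma IsTestFunction.hasDerivAt_slice (hζ : IsTestFunction (longDomain S ℓ) ζ) (s : ℝ) (y : E d) :
    HasDerivAt (fun s => ζ (joinPt s y)) (gradient ζ (joinPt s y) 0) s := by
  have h := (hζ.differentiable (joinPt s y)).hasFDerivAt.comp_hasDerivAt s
    (hasDerivAt_joinPt_left s y)
  refine h.congr_deriv ?_
  rw [← inner_gradient_left, inner_split]
  simp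

end slice

/-- A field orthogonal to the gradients of all tensor products of test functions is orthogonal to
the gradients of all test functions. -/
lemma integral_inner_gradient_eq_zero (hS : MeasurableSet S) (hfin : volume S ≠ ⊤)
    {w : E (d + 1) → E (d + 1)} (hw : MemLp w 2 (volume.restrict (longDomain S ℓ)))
    (horth : ∀ φ χ, IsTestProfile ℓ φ → IsTestFunction S χ →
      ∫ x in longDomain S ℓ, inner ℝ (w x) (tensorGrad φ χ (gradient χ) x) = 0)
    {ζ : E (d + 1) → ℝ} (hζ : IsTestFunction (longDomain S ℓ) ζ) :
    ∫ x in longDomain S ℓ, inner ℝ (w x) (gradient ζ x) = 0 := by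
  have : IsFiniteMeasure (volume.restrict (longDomain S ℓ)) :=
    ⟨by simpa using (volume_longDomain_ne_top hS hfin ℓ).lt_top⟩
  have hw1 : Integrable w (volume.restrict (longDomain S ℓ)) := hw.integrable (by norm_num)
  have h0c : Continuous fun x : E (d + 1) => x 0 :=
    (EuclideanSpace.proj 0 : E (d + 1) →L[ℝ] ℝ).continuous
  set K : Set ℝ := (fun x : E (d + 1) => x 0) '' tsupport ζ with hKdef
  have hK : IsCompact K := hζ.2.1.image h0c
  have hKsub : K ⊆ Set.Ioo (-ℓ) ℓ := by
    rintro _ ⟨x, hx, rfl⟩; exact (hζ.2.2 hx).1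
  have hζK : ∀ s, s ∉ K → ∀ y, ζ (joinPt s y) = 0 := by
    intro s hs y
    refine image_eq_zero_of_notMem_tsupport fun hx => hs ⟨_, hx, by simp⟩
  have hgK : ∀ s, s ∉ K → ∀ y, gradient ζ (joinPt s y) = 0 := by
    intro s hs y
    have : fderiv ℝ ζ (joinPt s y) = 0 := image_eq_zero_of_notMem_tsupport fun hx =>
      hs ⟨_, tsupport_fderiv_subset ℝ hx, by simp⟩
    simp [gradient, this]
  -- A margin that keeps bumps of radius at most η centred in `K` inside (-ℓ, ℓ).
  obtain ⟨η, hη, hηK⟩ := hK.exists_cthickening_subset_open isOpen_Ioo hKsub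
  have huc : UniformContinuous (gradient ζ) :=
    hζ.continuous_gradient.uniformContinuous_of_tendsto_cocompact
      (hζ.hasCompactSupport_gradient.is_zero_at_infty)
  -- Mollify ζ in x₁ only. The result ∫ ρ(x₁ - s) ζ(s, x') ds is a superposition of the tensor
  -- products ρ(· - s) ⊗ ζ(s, ·), so its gradient is orthogonal to `w` by Fubini, and this gradient
  -- is uniformly within κ of ∇ζ.
  have key : ∀ κ > 0, |∫ x in longDomain S ℓ, inner ℝ (w x) (gradient ζ x)| ≤
      κ * ∫ x in longDomain S ℓ, ‖w x‖ := by
    intro κ hκ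
    obtain ⟨ε', hε', hκ'⟩ := Metric.uniformContinuous_iff.1 huc κ hκ
    set ε := min ε' η with hε
    have hε0 : 0 < ε := lt_min hε' hη
    let b : ContDiffBump (0 : ℝ) := ⟨ε / 2, ε, by linarith, by linarith⟩
    set ρ : ℝ → ℝ := b.normed volume with hρ
    have hρc : ContDiff ℝ ((⊤ : ℕ∞) : WithTop ℕ∞) ρ := b.contDiff_normed
    have hρs : tsupport ρ = Metric.closedBall 0 ε := b.tsupport_normed_eq
    have hρcs : HasCompactSupport ρ := b.hasCompactSupport_normed
    have hρdc := continuous_deriv_of_contDiff hρc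
    have hprof : ∀ s ∈ K, IsTestProfile ℓ fun t => ρ (t - s) := by
      intro s hs
      have h0 : ∀ t, t ∉ Metric.closedBall s ε → ρ (t - s) = 0 := by
        intro t ht
        refine image_eq_zero_of_notMem_tsupport ?_
        rw [hρs]
        simpa [Real.dist_eq] using ht
      refine ⟨hρc.comp (contDiff_id.sub contDiff_const),
        HasCompactSupport.intro (isCompact_closedBall s ε) h0, ?_⟩
      have hsub : tsupport (fun t => ρ (t - s)) ⊆ Metric.closedBall s ε :=
        closure_minimal (fun x hx => by_contra fun hx' => hx (h0 x hx'))
          Metric.isClosed_closedBall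
      refine hsub.trans (((Metric.closedBall_subset_closedBall (min_le_right _ _)).trans
        (Metric.closedBall_subset_cthickening hs η)).trans hηK)
    -- The gradient in x of ρ(x₁ - s) ζ(s, x').
    set V : E (d + 1) → ℝ → E (d + 1) := fun x s =>
      (deriv ρ (x 0 - s) * ζ (joinPt s (crossPart x))) • axis d +
        crossEmb d (ρ (x 0 - s) • crossPart (gradient ζ (joinPt s (crossPart x)))) with hV
    have hVt : ∀ x s, V x s = tensorGrad (fun t => ρ (t - s)) (fun y => ζ (joinPt s y))
        (gradient fun y => ζ (joinPt s y)) x := by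
      intro x s
      rw [tensorGrad_apply, hζ.gradient_slice, deriv_comp_sub_const]
    have hV0 : ∀ x s, s ∉ K → V x s = 0 := by
      intro x s hs
      have : crossPart (0 : E (d + 1)) = 0 := map_zero (crossProj d)
      simp [hV, hζK s hs, hgK s hs, this]
    have hVint : ∀ s, ∫ x in longDomain S ℓ, inner ℝ (w x) (V x s) = 0 := by
      intro s
      by_cases hs : s ∈ K
      · simp only [hVt]
        exact horth _ _ (hprof s hs) (hζ.slice s)
      · simp [hV0 _ s hs]
    have hjc : Continuous fun z : E (d + 1) × ℝ => joinPt z.2 (crossPart z.1) :=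
      continuous_joinPt.comp (continuous_snd.prodMk (continuous_crossPart.comp continuous_fst))
    have hdc : Continuous fun z : E (d + 1) × ℝ => z.1 0 - z.2 :=
      (h0c.comp continuous_fst).sub continuous_snd
    have hVc : Continuous fun z : E (d + 1) × ℝ => V z.1 z.2 := by
      refine (((hρdc.comp hdc).mul (hζ.continuous.comp hjc)).smul continuous_const).add
        ((crossEmb d).continuous.comp ((hρc.continuous.comp hdc).smul
          (continuous_crossPart.comp (hζ.continuous_gradient.comp hjc))))
    obtain ⟨B1, hB1⟩ := hρdc.bounded_above_of_compact_support hρcs.deriv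
    obtain ⟨B2, hB2⟩ := hζ.continuous.bounded_above_of_compact_support hζ.2.1
    obtain ⟨B3, hB3⟩ := hρc.continuous.bounded_above_of_compact_support hρcs
    obtain ⟨B4, hB4⟩ := hζ.continuous_gradient.bounded_above_of_compact_support
      hζ.hasCompactSupport_gradient
    have hB1' := (norm_nonneg _).trans (hB1 0)
    have hB3' := (norm_nonneg _).trans (hB3 0)
    have hcross : ∀ x : E (d + 1), ‖crossPart x‖ ≤ ‖x‖ := by
      intro x
      refine (sq_le_sq₀ (norm_nonneg _) (norm_nonneg _)).1 ?_
      rw [← real_inner_self_eq_norm_sq, ← real_inner_self_eq_norm_sq, inner_split x x]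
      nlinarith [mul_self_nonneg (x 0)]
    have hVb : ∀ x s, ‖V x s‖ ≤ B1 * B2 + B3 * B4 := by
      intro x s
      refine (norm_add_le _ _).trans ?_
      rw [norm_crossEmb, norm_smul, norm_smul, norm_axis, mul_one, norm_mul]
      gcongr
      · exact hB1 _
      · exact hB2 _
      · exact hB3 _
      · exact (hcross _).trans (hB4 _)
    set ν : Measure ℝ := volume.restrict (Set.Ioo (-ℓ) ℓ) with hν
    have hfub : Integrable (fun z : E (d + 1) × ℝ => inner ℝ (w z.1) (V z.1 z.2))
        ((volume.restrict (longDomain S ℓ)).prod ν) := by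
      have hi : Integrable (fun z : E (d + 1) × ℝ => ‖w z.1‖ * (B1 * B2 + B3 * B4))
          ((volume.restrict (longDomain S ℓ)).prod ν) :=
        (hw1.norm.comp_fst ν).mul_const _
      refine hi.mono' (hw1.1.comp_fst.inner hVc.aestronglyMeasurable)
        (Eventually.of_forall fun z => ?_)
      refine (norm_inner_le_norm _ _).trans ?_
      gcongr
      exact hVb _ _
    have hswap := integral_integral_swap (f := fun x s => inner ℝ (w x) (V x s)) hfub
    -- Integrating by parts in s moves the derivative from ρ to ζ, so that averaging `V` gives the
    -- mollification of ∇ζ.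
    have hVL : ∀ x, ∫ s, inner ℝ (w x) (V x s) ∂ν =
        inner ℝ (w x) (∫ s, ρ (x 0 - s) • gradient ζ (joinPt s (crossPart x))) := by
      intro x
      have hjs : Continuous fun s : ℝ => joinPt s (crossPart x) :=
        continuous_joinPt.comp (continuous_id.prodMk continuous_const)
      have hK' : ∀ {F : Type} [NormedAddCommGroup F] {f : ℝ → F}, Continuous f →
          (∀ s, s ∉ K → f s = 0) → Integrable f volume := fun hf hf0 =>
        hf.integrable_of_hasCompactSupport (HasCompactSupport.intro hK hf0)
      have c1 : Continuous fun s => deriv ρ (x 0 - s) := by fun_prop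
      have c2 : Continuous fun s => ρ (x 0 - s) := hρc.continuous.comp (by fun_prop)
      have c3 : Continuous fun s => ζ (joinPt s (crossPart x)) := hζ.continuous.comp hjs
      have c4 : Continuous fun s => gradient ζ (joinPt s (crossPart x)) :=
        hζ.continuous_gradient.comp hjs
      have c5 : Continuous fun s => gradient ζ (joinPt s (crossPart x)) 0 := h0c.comp c4
      have iV : Integrable (V x) volume :=
        hK' (hVc.comp (continuous_const.prodMk continuous_id)) (hV0 x)
      have iG : Integrable (fun s => ρ (x 0 - s) • gradient ζ (joinPt s (crossPart x))) volume :=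
        hK' (c2.smul c4) fun s hs => by simp [hgK s hs]
      have i1 : Integrable (fun s => deriv ρ (x 0 - s) * ζ (joinPt s (crossPart x))) volume :=
        hK' (c1.mul c3) fun s hs => by simp [hζK s hs]
      have i2 : Integrable (fun s => ρ (x 0 - s) * gradient ζ (joinPt s (crossPart x)) 0)
          volume := hK' (c2.mul c5) fun s hs => by simp [hgK s hs]
      have hibp : ∫ s, ρ (x 0 - s) * gradient ζ (joinPt s (crossPart x)) 0 =
          ∫ s, deriv ρ (x 0 - s) * ζ (joinPt s (crossPart x)) := by
        have hd1 : ∀ s, HasDerivAt (fun s => ρ (x 0 - s)) (-deriv ρ (x 0 - s)) s := by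
          intro s
          have := ((hρc.differentiable (by simp) (x 0 - s)).hasDerivAt).comp s
            ((hasDerivAt_id s).const_sub (x 0))
          rw [mul_neg, mul_one] at this
          exact this
        rw [integral_mul_deriv_eq_deriv_mul_of_integrable (fun s _ => hd1 s)
          (fun s _ => hζ.hasDerivAt_slice s (crossPart x)) i2
          (i1.neg.congr (Eventually.of_forall fun s => by simp))
          (hK' (c2.mul c3) fun s hs => by simp [hζK s hs])]
        simp [integral_neg]
      rw [hν, setIntegral_eq_integral_of_forall_compl_eq_zero
        (fun s hs => by rw [hV0 x s fun h => hs (hKsub h), inner_zero_right]),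
        integral_inner iV]
      congr 1
      -- The discrepancy points along the axis, and its integral over s vanishes by `hibp`.
      have hVeq : ∀ s, V x s = ρ (x 0 - s) • gradient ζ (joinPt s (crossPart x)) +
          (deriv ρ (x 0 - s) * ζ (joinPt s (crossPart x)) -
            ρ (x 0 - s) * gradient ζ (joinPt s (crossPart x)) 0) • axis d := by
        intro s
        ext i
        refine Fin.cases ?_ (fun j => ?_) i <;> simp [hV]
      have i3 : Integrable (fun s => (deriv ρ (x 0 - s) * ζ (joinPt s (crossPart x)) -
          ρ (x 0 - s) * gradient ζ (joinPt s (crossPart x)) 0) • axis d) volume :=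
        (i1.sub i2).smul_const _
      simp only [hVeq]
      rw [integral_add iG i3, integral_smul_const, integral_sub i1 i2,
        hibp, sub_self, zero_smul, add_zero]
    -- The mollified gradient averages values of ∇ζ at points closer than ε to x, where uniform
    -- continuity applies.
    have hclose : ∀ x, dist (∫ s, ρ (x 0 - s) • gradient ζ (joinPt s (crossPart x)))
        (gradient ζ x) ≤ κ := by
      intro x
      have hjs : Continuous fun s : ℝ => joinPt s (crossPart x) :=
        continuous_joinPt.comp (continuous_id.prodMk continuous_const)
      have := b.dist_normed_convolution_le (μ := volume) (x₀ := x 0) (ε := κ)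
        (g := fun s => gradient ζ (joinPt s (crossPart x)))
        (hζ.continuous_gradient.comp hjs).aestronglyMeasurable (fun s hs => by
          refine (hκ' ?_).le
          have h1 : dist s (x 0) < ε := hs
          have h2 : joinPt s (crossPart x) - joinPt (x 0) (crossPart x) = (s - x 0) • axis d := by
            simp [joinPt, sub_smul]
          rw [dist_eq_norm, h2, norm_smul, norm_axis, mul_one, ← dist_eq_norm]
          exact h1.trans_le (min_le_left _ _))
      rw [convolution_eq_swap] at this
      simpa using this
    have hzero : ∫ x in longDomain S ℓ,
        inner ℝ (w x) (∫ s, ρ (x 0 - s) • gradient ζ (joinPt s (crossPart x))) = 0 := by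
      simp only [← hVL]
      rw [hswap]
      simp [hVint]
    have hi2 : Integrable (fun x => inner ℝ (w x)
        (∫ s, ρ (x 0 - s) • gradient ζ (joinPt s (crossPart x))))
        (volume.restrict (longDomain S ℓ)) := by
      simp only [← hVL]
      exact hfub.integral_prod_left
    have hi1 : Integrable (fun x => inner ℝ (w x) (gradient ζ x))
        (volume.restrict (longDomain S ℓ)) := by
      have h := L2.integrable_inner (𝕜 := ℝ) (hw.toLp w) (hζ.memLp_gradient.toLp (gradient ζ))
      refine h.congr ?_
      filter_upwards [hw.coeFn_toLp, (hζ.memLp_gradient (p := 2)).coeFn_toLp] with x h1 h2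
      rw [h1, h2]
    have hsub : ∫ x in longDomain S ℓ, inner ℝ (w x) (gradient ζ x) =
        ∫ x in longDomain S ℓ, inner ℝ (w x)
          (gradient ζ x - ∫ s, ρ (x 0 - s) • gradient ζ (joinPt s (crossPart x))) := by
      simp only [inner_sub_right]
      rw [integral_sub hi1 hi2, hzero, sub_zero]
    rw [hsub, ← Real.norm_eq_abs, mul_comm, ← integral_mul_const]
    refine norm_integral_le_of_norm_le (hw1.norm.mul_const κ) (Eventually.of_forall fun x => ?_)
    refine (norm_inner_le_norm _ _).trans ?_
    gcongr
    rw [← dist_eq_norm, dist_comm]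
    exact hclose x
  set I := ∫ x in longDomain S ℓ, ‖w x‖ with hI
  have hI0 : 0 ≤ I := integral_nonneg fun _ => norm_nonneg _
  rw [← abs_nonpos_iff]
  refine le_of_forall_pos_le_add fun e he => ?_
  -- I + 1 instead of I, which may be zero.
  have := key (e / (I + 1)) (by positivity)
  rw [zero_add]
  refine this.trans ?_
  rw [div_mul_eq_mul_div, div_le_iff₀ (by positivity)]
  nlinarith

end

/-! ### Finite-dimensional diagonalisation, and ∇(p ⊗ x) as a linear map of x ∈ H¹₀(S). -/

section

/-- A linear map on a finite-dimensional inner product space sends a suitable orthonormal basis to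
an orthogonal family. -/
lemma exists_orthonormalBasis_orthogonal_map {V F : Type*} [NormedAddCommGroup V]
    [InnerProductSpace ℝ V] [FiniteDimensional ℝ V] [NormedAddCommGroup F]
    [InnerProductSpace ℝ F] [CompleteSpace F] (L : V →ₗ[ℝ] F) :
    ∃ (n : ℕ) (b : OrthonormalBasis (Fin n) ℝ V),
      ∀ i j, i ≠ j → inner ℝ (L (b i)) (L (b j)) = 0 := by
  have : CompleteSpace V := FiniteDimensional.complete ℝ V
  -- Continuity, hence the adjoint, comes from the finite dimension of `V`; the gradient need not be
  -- bounded for the L² norm. The basis consists of eigenvectors of L*L, for which ⟨L bᵢ, L bⱼ⟩ =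
  -- ⟨L*L bᵢ, bⱼ⟩.
  set L' : V →L[ℝ] F := LinearMap.toContinuousLinearMap L with hL'
  set A : V →L[ℝ] V := (ContinuousLinearMap.adjoint L').comp L' with hA
  have hAin : ∀ x y, inner ℝ (A x) y = inner ℝ (L x) (L y) := fun x y => by
    rw [hA, ContinuousLinearMap.comp_apply, ContinuousLinearMap.adjoint_inner_left]; rfl
  have hsym : (A : V →ₗ[ℝ] V).IsSymmetric := fun x y => by
    rw [ContinuousLinearMap.coe_coe, hAin, real_inner_comm, ← hAin, real_inner_comm]
  refine ⟨_, hsym.eigenvectorBasis rfl, fun i j hij => ?_⟩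
  rw [← hAin]
  have h := hsym.apply_eigenvectorBasis rfl i
  rw [ContinuousLinearMap.coe_coe] at h
  rw [h, inner_smul_left, (hsym.eigenvectorBasis rfl).inner_eq_zero hij, mul_zero]

/-- A linear map sends a suitable orthonormal family, whose span contains a given finite set, to an
orthogonal family. -/
lemma exists_orthonormal_orthogonal_map {H F : Type*} [NormedAddCommGroup H]
    [InnerProductSpace ℝ H] [NormedAddCommGroup F] [InnerProductSpace ℝ F] [CompleteSpace F]
    (L : H →ₗ[ℝ] F) {A : Set H} (hA : A.Finite) :
    ∃ (n : ℕ) (b : Fin n → H), Orthonormal ℝ b ∧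
      (∀ i j, i ≠ j → inner ℝ (L (b i)) (L (b j)) = 0) ∧
      ∀ v ∈ A, ∃ a : Fin n → ℝ, v = ∑ i, a i • b i := by
  set W : Submodule ℝ H := Submodule.span ℝ A with hW
  have : FiniteDimensional ℝ W := FiniteDimensional.span_of_finite ℝ hA
  obtain ⟨n, b, hb⟩ := exists_orthonormalBasis_orthogonal_map (L.comp W.subtype)
  refine ⟨n, fun i => b i, b.orthonormal.comp_linearIsometry W.subtypeₗᵢ, hb, fun v hv => ?_⟩
  have hvW : v ∈ W := Submodule.subset_span hv
  refine ⟨fun i => b.repr ⟨v, hvW⟩ i, ?_⟩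
  have := congrArg (Subtype.val) (b.sum_repr ⟨v, hvW⟩)
  simpa using this.symm

/-- Restriction of `L²` classes to a smaller measure. -/
noncomputable def restrictLp {X F : Type*} [MeasurableSpace X] [NormedAddCommGroup F]
    [NormedSpace ℝ F] {μ ν : Measure X} (h : ν ≤ μ) : Lp F 2 μ →ₗ[ℝ] Lp F 2 ν where
  toFun f := ((Lp.memLp f).mono_measure h).toLp f
  map_add' f g := by
    rw [← MemLp.toLp_add]
    exact MemLp.toLp_congr _ _ (h.absolutelyContinuous.ae_le (Lp.coeFn_add f g))
  map_smul' c f := by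
    rw [RingHom.id_apply, ← MemLp.toLp_const_smul]
    exact MemLp.toLp_congr _ _ (h.absolutelyContinuous.ae_le (Lp.coeFn_smul c f))

lemma norm_restrictLp_le {X F : Type*} [MeasurableSpace X] [NormedAddCommGroup F]
    [NormedSpace ℝ F] {μ ν : Measure X} (h : ν ≤ μ) (f : Lp F 2 μ) : ‖restrictLp h f‖ ≤ ‖f‖ := by
  have e : restrictLp h f = ((Lp.memLp f).mono_measure h).toLp f := rfl
  rw [e, Lp.norm_toLp, Lp.norm_def]
  exact ENNReal.toReal_mono (Lp.memLp f).2.ne (eLpNorm_mono_measure _ h)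

lemma restrictLp_toLp {X F : Type*} [MeasurableSpace X] [NormedAddCommGroup F]
    [NormedSpace ℝ F] {μ ν : Measure X} (h : ν ≤ μ) {f : X → F} (hf : MemLp f 2 μ) :
    restrictLp h (hf.toLp f) = (hf.mono_measure h).toLp f :=
  MemLp.toLp_congr ((Lp.memLp (hf.toLp f)).mono_measure h) _
    (h.absolutelyContinuous.ae_le hf.coeFn_toLp)

lemma inner_toLp {X F : Type*} [MeasurableSpace X] [NormedAddCommGroup F]
    [InnerProductSpace ℝ F] {μ : Measure X} {a b : X → F} (ha : MemLp a 2 μ) (hb : MemLp b 2 μ) :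
    inner ℝ (ha.toLp a) (hb.toLp b) = ∫ x, inner ℝ (a x) (b x) ∂μ := by
  rw [L2.inner_def]
  refine integral_congr_ae ?_
  filter_upwards [ha.coeFn_toLp, hb.coeFn_toLp] with x h1 h2
  rw [h1, h2]

lemma integrable_inner_of_memLp {X F : Type*} [MeasurableSpace X] [NormedAddCommGroup F]
    [InnerProductSpace ℝ F] {μ : Measure X} {a b : X → F} (ha : MemLp a 2 μ) (hb : MemLp b 2 μ) :
    Integrable (fun x => inner ℝ (a x) (b x)) μ := by
  refine (L2.integrable_inner (𝕜 := ℝ) (ha.toLp a) (hb.toLp b)).congr ?_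
  filter_upwards [ha.coeFn_toLp, hb.coeFn_toLp] with x h1 h2
  rw [h1, h2]

variable {d : ℕ} {S : Set (E d)} {ℓ : ℝ}

lemma H10Pair.ae_unique (hS : IsOpen S) (hfin : volume S ≠ ⊤) {u : E d → ℝ} {g g' : E d → E d}
    (h : H10Pair S u g) (h' : H10Pair S u g') : g =ᵐ[volume.restrict S] g' :=
  (h.h1Pair hfin).isWeakGrad.ae_eq hS (h'.h1Pair hfin).isWeakGrad

/-- `H¹₀(S)` as a subspace of `L²(S)`. -/
noncomputable def h10Space (S : Set (E d)) : Submodule ℝ (Lp ℝ 2 (volume.restrict S)) where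
  carrier := {x | ∃ g, H10Pair S x g}
  add_mem' := by
    rintro x y ⟨g, hg⟩ ⟨h, hh⟩
    exact ⟨g + h, (hg.add hh).congr (Lp.coeFn_add x y).symm (ae_eq_refl _)⟩
  zero_mem' := by
    have h0 : IsTestFunction S 0 := ⟨contDiff_zero_fun, HasCompactSupport.zero, by simp [tsupport]⟩
    exact ⟨_, h0.h10Pair.congr (Lp.coeFn_zero _ _ _).symm (ae_eq_refl _)⟩
  smul_mem' := by
    rintro c x ⟨g, hg⟩
    exact ⟨c • g, (hg.const_smul c).congr (Lp.coeFn_smul c x).symm (ae_eq_refl _)⟩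

/-- A representative of the gradient of an element of `H¹₀(S)`. -/
noncomputable def gradRep (x : h10Space S) : E d → E d := x.2.choose

lemma h10Pair_gradRep (x : h10Space S) : H10Pair S x (gradRep x) := x.2.choose_spec

/-- The element of `h10Space S` given by a function in `H¹₀(S)`. -/
noncomputable def H10Pair.toH10 {u : E d → ℝ} {g : E d → E d} (h : H10Pair S u g) : h10Space S :=
  ⟨h.memLp.toLp u, g, h.congr h.memLp.coeFn_toLp.symm (ae_eq_refl _)⟩

lemma H10Pair.coeFn_toH10 {u : E d → ℝ} {g : E d → E d} (h : H10Pair S u g) :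
    (h.toH10 : Lp ℝ 2 (volume.restrict S)) =ᵐ[volume.restrict S] u := h.memLp.coeFn_toLp

lemma H10Pair.gradRep_toH10 (hS : IsOpen S) (hfin : volume S ≠ ⊤) {u : E d → ℝ} {g : E d → E d}
    (h : H10Pair S u g) : gradRep h.toH10 =ᵐ[volume.restrict S] g :=
  (h10Pair_gradRep h.toH10).ae_unique hS hfin (h.congr h.coeFn_toH10.symm (ae_eq_refl _))

/-- The representatives are chosen independently for each element; linearity almost everywhere comes
from uniqueness of weak gradients. -/
lemma gradRep_add (hS : IsOpen S) (hfin : volume S ≠ ⊤) (x y : h10Space S) :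
    gradRep (x + y) =ᵐ[volume.restrict S] gradRep x + gradRep y :=
  (h10Pair_gradRep (x + y)).ae_unique hS hfin
    (((h10Pair_gradRep x).add (h10Pair_gradRep y)).congr (Lp.coeFn_add _ _).symm (ae_eq_refl _))

lemma gradRep_smul (hS : IsOpen S) (hfin : volume S ≠ ⊤) (c : ℝ) (x : h10Space S) :
    gradRep (c • x) =ᵐ[volume.restrict S] c • gradRep x :=
  (h10Pair_gradRep (c • x)).ae_unique hS hfin
    (((h10Pair_gradRep x).const_smul c).congr (Lp.coeFn_smul _ _).symm (ae_eq_refl _))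

/-- The gradient as a linear map on `H¹₀(S)`. -/
noncomputable def gradMap (hS : IsOpen S) (hfin : volume S ≠ ⊤) :
    h10Space S →ₗ[ℝ] Lp (E d) 2 (volume.restrict S) where
  toFun x := (h10Pair_gradRep x).memLp_grad.toLp (gradRep x)
  map_add' x y := by
    rw [← MemLp.toLp_add]
    exact MemLp.toLp_congr _ _ (gradRep_add hS hfin x y)
  map_smul' c x := by
    rw [RingHom.id_apply, ← MemLp.toLp_const_smul]
    exact MemLp.toLp_congr _ _ (gradRep_smul hS hfin c x)

/-- Null sets of the cross-section lift to null sets of the cylinder, so the tensor gradient is well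
defined on classes. -/
lemma tensorGrad_congr (hS : MeasurableSet S) (s : ℝ) {p : ℝ → ℝ} {u u' : E d → ℝ}
    {g g' : E d → E d} (hu : u =ᵐ[volume.restrict S] u') (hg : g =ᵐ[volume.restrict S] g') :
    tensorGrad p u g =ᵐ[volume.restrict (longDomain S s)] tensorGrad p u' g' := by
  filter_upwards [ae_longDomain_of_ae hS s hu, ae_longDomain_of_ae hS s hg] with x h1 h2
  rw [tensorGrad_apply, tensorGrad_apply, h1, h2]

lemma tensorGrad_add (p : ℝ → ℝ) (u v : E d → ℝ) (g h : E d → E d) :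
    tensorGrad p (u + v) (g + h) = tensorGrad p u g + tensorGrad p v h := by
  ext1 z
  simp only [tensorGrad_apply, Pi.add_apply, mul_add, add_smul, smul_add, map_add]
  abel

lemma tensorGrad_smul (p : ℝ → ℝ) (c : ℝ) (u : E d → ℝ) (g : E d → E d) :
    tensorGrad p (c • u) (c • g) = c • tensorGrad p u g := by
  ext1 z
  simp only [tensorGrad_apply, Pi.smul_apply, smul_add, map_smul, smul_eq_mul]
  rw [smul_comm c (p (z 0)), smul_smul c, mul_left_comm]

lemma memLp_tensorGrad_rep (hS : IsOpen S) (s : ℝ) {p : ℝ → ℝ}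
    (hp : ContDiff ℝ ((⊤ : ℕ∞) : WithTop ℕ∞) p) (x : h10Space S) :
    MemLp (tensorGrad p x (gradRep x)) 2 (volume.restrict (longDomain S s)) :=
  memLp_tensorGrad hS.measurableSet hp (h10Pair_gradRep x).memLp (h10Pair_gradRep x).memLp_grad s

/-- The class of `∇(p ⊗ x)` in `L²(Ω_s)`, for smooth `p`, as a linear map in `x ∈ H¹₀(S)`. -/
noncomputable def tensorMap (hS : IsOpen S) (hfin : volume S ≠ ⊤) (s : ℝ) {p : ℝ → ℝ}
    (hp : ContDiff ℝ ((⊤ : ℕ∞) : WithTop ℕ∞) p) :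
    h10Space S →ₗ[ℝ] Lp (E (d + 1)) 2 (volume.restrict (longDomain S s)) where
  toFun x := (memLp_tensorGrad_rep hS s hp x).toLp (tensorGrad p x (gradRep x))
  map_add' x y := by
    rw [← MemLp.toLp_add]
    refine MemLp.toLp_congr _ _ ?_
    rw [← tensorGrad_add]
    exact tensorGrad_congr hS.measurableSet s
      (Lp.coeFn_add (x : Lp ℝ 2 (volume.restrict S)) y) (gradRep_add hS hfin x y)
  map_smul' c x := by
    have hx := memLp_tensorGrad_rep hS s hp x
    refine (MemLp.toLp_congr _ (hx.const_smul c) ?_).trans (MemLp.toLp_const_smul c hx)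
    rw [← tensorGrad_smul]
    exact tensorGrad_congr hS.measurableSet s
      (Lp.coeFn_smul c (x : Lp ℝ 2 (volume.restrict S))) (gradRep_smul hS hfin c x)

/-- Fubini reduces the Dirichlet form on the cylinder to the L² product and the Dirichlet form on
`S`, with one-dimensional integrals as coefficients. An orthonormal family with orthogonal gradients
diagonalises both at once. -/
lemma inner_tensorMap (hS : IsOpen S) (hfin : volume S ≠ ⊤) (s : ℝ) {p q : ℝ → ℝ}
    (hp : ContDiff ℝ ((⊤ : ℕ∞) : WithTop ℕ∞) p) (hq : ContDiff ℝ ((⊤ : ℕ∞) : WithTop ℕ∞) q)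
    (x y : h10Space S) :
    inner ℝ (tensorMap hS hfin s hp x) (tensorMap hS hfin s hq y) =
      (∫ t in Set.Ioo (-s) s, deriv p t * deriv q t) * inner ℝ x y +
        (∫ t in Set.Ioo (-s) s, p t * q t) *
          inner ℝ (gradMap hS hfin x) (gradMap hS hfin y) := by
  have hm := hS.measurableSet
  have e0 : inner ℝ (tensorMap hS hfin s hp x) (tensorMap hS hfin s hq y) =
      ∫ z in longDomain S s, inner ℝ (tensorGrad p x (gradRep x) z)
        (tensorGrad q y (gradRep y) z) :=
    inner_toLp (memLp_tensorGrad_rep hS s hp x) (memLp_tensorGrad_rep hS s hq y)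
  have e1 : inner ℝ x y = ∫ z in S, (x : Lp ℝ 2 (volume.restrict S)) z *
      (y : Lp ℝ 2 (volume.restrict S)) z := by
    rw [Submodule.coe_inner, L2.inner_def]
    simp [mul_comm]
  have e2 : inner ℝ (gradMap hS hfin x) (gradMap hS hfin y) =
      ∫ z in S, inner ℝ (gradRep x z) (gradRep y z) :=
    inner_toLp (h10Pair_gradRep x).memLp_grad (h10Pair_gradRep y).memLp_grad
  rw [e0, e1, e2, ← setIntegral_longDomain_mul hm s (fun t => deriv p t * deriv q t)
    (fun z => (x : Lp ℝ 2 (volume.restrict S)) z * (y : Lp ℝ 2 (volume.restrict S)) z),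
    ← setIntegral_longDomain_mul hm s (fun t => p t * q t)
    (fun z => inner ℝ (gradRep x z) (gradRep y z))]
  simp only [inner_tensorGrad]
  have hb : ∀ {r : ℝ → ℝ}, Continuous r → Integrable r (volume.restrict (Set.Ioo (-s) s)) :=
    fun hr => hr.integrableOn_Icc.mono_set Set.Ioo_subset_Icc_self
  have hint : ∀ {r : ℝ → ℝ} {h : E d → ℝ}, Continuous r → Integrable h (volume.restrict S) →
      Integrable (fun z : E (d + 1) => r (z 0) * h (crossPart z))
        (volume.restrict (longDomain S s)) := fun hr hh =>
    (measurePreserving_split_longDomain hm s).integrable_comp_of_integrable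
      ((hb hr).mul_prod hh)
  have i1 := integrable_inner_of_memLp (h10Pair_gradRep y).memLp (h10Pair_gradRep x).memLp
  simp only [RCLike.inner_apply, conj_trivial] at i1
  exact integral_add
    (hint ((continuous_deriv_of_contDiff hp).mul (continuous_deriv_of_contDiff hq)) i1)
    (hint (hp.continuous.mul hq.continuous)
      (integrable_inner_of_memLp (h10Pair_gradRep x).memLp_grad (h10Pair_gradRep y).memLp_grad))

lemma tensorMap_sub (hS : IsOpen S) (hfin : volume S ≠ ⊤) (s : ℝ) {p q : ℝ → ℝ}
    (hp : ContDiff ℝ ((⊤ : ℕ∞) : WithTop ℕ∞) p) (hq : ContDiff ℝ ((⊤ : ℕ∞) : WithTop ℕ∞) q)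
    (x : h10Space S) :
    tensorMap hS hfin s hp x - tensorMap hS hfin s hq x =
      tensorMap hS hfin s (p := fun t => p t - q t) (hp.sub hq) x := by
  have hx := memLp_tensorGrad_rep hS s hp x
  have hy := memLp_tensorGrad_rep hS s hq x
  refine (MemLp.toLp_sub hx hy).symm.trans ?_
  refine MemLp.toLp_congr (hx.sub hy) (memLp_tensorGrad_rep hS s (hp.sub hq) x)
    (Eventually.of_forall fun z => ?_)
  have : deriv (fun t => p t - q t) (z 0) = deriv p (z 0) - deriv q (z 0) :=
    deriv_fun_sub (hp.differentiable (by simp) _) (hq.differentiable (by simp) _)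
  simp only [Pi.sub_apply, tensorGrad_apply, this, sub_mul, sub_smul, map_sub]
  abel

lemma restrictLp_tensorMap (hS : IsOpen S) (hfin : volume S ≠ ⊤) {s : ℝ}
    (h : volume.restrict (longDomain S s) ≤ volume.restrict (longDomain S ℓ)) {p : ℝ → ℝ}
    (hp : ContDiff ℝ ((⊤ : ℕ∞) : WithTop ℕ∞) p) (x : h10Space S) :
    restrictLp h (tensorMap hS hfin ℓ hp x) = tensorMap hS hfin s hp x :=
  restrictLp_toLp h (memLp_tensorGrad_rep hS ℓ hp x)

end

/-! ### Galerkin approximation of ∇u_ℓ by separated solutions. -/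

section

section abstract
variable {H F X : Type*} [NormedAddCommGroup H] [InnerProductSpace ℝ H] [NormedAddCommGroup F]
  [InnerProductSpace ℝ F] [NormedAddCommGroup X] [InnerProductSpace ℝ X]

/-- If a family `b` is orthonormal and `L b` is orthogonal, then `∑ aᵢ Qᵢ bᵢ` solves the Galerkin
equations as soon as each `Qᵢ bᵢ` solves a scalar one. -/
lemma inner_sub_sum_eq_zero {n : ℕ} {b : Fin n → H} {a : Fin n → ℝ} {L : H →ₗ[ℝ] F}
    {P : H →ₗ[ℝ] X} {Q : Fin n → H →ₗ[ℝ] X} {α β : Fin n → ℝ} {I : ℝ} {G : X} {U : H}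
    (hbo : Orthonormal ℝ b) (hborth : ∀ i j, i ≠ j → inner ℝ (L (b i)) (L (b j)) = 0)
    (hU : U = ∑ i, a i • b i)
    (hin : ∀ i x y, inner ℝ (Q i x) (P y) = α i * inner ℝ x y + β i * inner ℝ (L x) (L y))
    (hG : ∀ x, inner ℝ G (P x) = I * inner ℝ (L U) (L x))
    (hrel : ∀ i, α i + ‖L (b i)‖ ^ 2 * β i = ‖L (b i)‖ ^ 2 * I) {v : H}
    (hv : ∃ c : Fin n → ℝ, v = ∑ i, c i • b i) :
    inner ℝ (G - ∑ i, a i • Q i (b i)) (P v) = 0 := by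
  obtain ⟨c, rfl⟩ := hv
  rw [map_sum, inner_sum]
  refine Finset.sum_eq_zero fun j _ => ?_
  rw [map_smul, inner_smul_right, inner_sub_left, hG, hU, map_sum, sum_inner, sum_inner,
    Finset.sum_eq_single j, Finset.sum_eq_single j, map_smul, inner_smul_left, inner_smul_left, hin,
    real_inner_self_eq_norm_sq, real_inner_self_eq_norm_sq, hbo.1 j]
  · have := hrel j
    simp only [conj_trivial]
    -- Only the diagonal term survives, and it is the scalar equation `hrel` for the index j.
    linear_combination (-c j * a j) * this
  · intro i _ hij
    rw [inner_smul_left, hin, hborth i j hij, hbo.2 hij]; simp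
  · simp
  · intro i _ hij
    rw [map_smul, inner_smul_left, hborth i j hij, mul_zero]
  · simp

/-- Pythagoras: both bilinear forms are diagonal on `b`, so the off-diagonal terms vanish for any
choice of coefficients. -/
lemma norm_sq_sum_eq {n : ℕ} {b : Fin n → H} {a : Fin n → ℝ} {L : H →ₗ[ℝ] F}
    {Q : Fin n → H →ₗ[ℝ] X} {α β : Fin n → Fin n → ℝ}
    (hbo : Orthonormal ℝ b) (hborth : ∀ i j, i ≠ j → inner ℝ (L (b i)) (L (b j)) = 0)
    (hin : ∀ i j x y, inner ℝ (Q i x) (Q j y) = α i j * inner ℝ x y +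
      β i j * inner ℝ (L x) (L y)) :
    ‖∑ i, a i • Q i (b i)‖ ^ 2 = ∑ i, a i ^ 2 * (α i i + ‖L (b i)‖ ^ 2 * β i i) := by
  rw [← real_inner_self_eq_norm_sq, sum_inner]
  refine Finset.sum_congr rfl fun i _ => ?_
  rw [inner_sum, Finset.sum_eq_single i]
  · rw [inner_smul_left, inner_smul_right, hin, real_inner_self_eq_norm_sq,
      real_inner_self_eq_norm_sq, hbo.1 i]
    simp only [conj_trivial]
    ring
  · intro j _ hij
    rw [inner_smul_left, inner_smul_right, hin, hborth i j hij.symm, hbo.2 hij.symm]; simp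
  · simp

lemma inner_sum_smul_eq_zero {n : ℕ} {z : X} {a : Fin n → ℝ} {y : Fin n → X}
    (h : ∀ i, inner ℝ z (y i) = 0) : inner ℝ z (∑ i, a i • y i) = 0 := by
  rw [inner_sum]
  exact Finset.sum_eq_zero fun i _ => by rw [inner_smul_right, h, mul_zero]

/-- Céa's argument: orthogonality gives ‖G - T‖² = ⟨G - T, G - y⟩, and Cauchy–Schwarz concludes. -/
lemma norm_sub_le_of_galerkin {G T y : X} {ε : ℝ} (h1 : inner ℝ (G - T) y = 0)
    (h2 : inner ℝ (G - T) T = 0) (h : ‖G - y‖ ≤ ε) : ‖G - T‖ ≤ ε := by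
  have hnorm : ‖G - T‖ ^ 2 ≤ ‖G - T‖ * ε := by
    have : inner ℝ (G - T) (G - T) = inner ℝ (G - T) (G - y) := by
      rw [inner_sub_right, inner_sub_right, h1, h2]
    rw [← real_inner_self_eq_norm_sq, this]
    refine (real_inner_le_norm _ _).trans ?_
    gcongr
  rcases (norm_nonneg (G - T)).eq_or_lt with h0 | h0
  · rw [← h0]; exact (norm_nonneg _).trans h
  · nlinarith

end abstract

variable {d : ℕ} {S : Set (E d)} {ℓ : ℝ}

/-- The gradients of the tensor products `φ ⊗ x`, with `φ ∈ C_c^∞(-ℓ, ℓ)` and `x ∈ H¹₀(S)`. -/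
def tensorFields (hS : IsOpen S) (hfin : volume S ≠ ⊤) (ℓ : ℝ) :
    Set (Lp (E (d + 1)) 2 (volume.restrict (longDomain S ℓ))) :=
  {y | ∃ (φ : ℝ → ℝ) (hφ : IsTestProfile ℓ φ) (x : h10Space S),
    y = tensorMap hS hfin ℓ hφ.1 x}

/-- By Hilbert space duality it suffices that every `w` orthogonal to the tensor fields is
orthogonal to `g`. Such a `w` is orthogonal to all gradients of test functions, and `g` is a limit
of these. -/
lemma mem_closure_tensorFields (hS : IsOpen S) (hfin : volume S ≠ ⊤) {u : E (d + 1) → ℝ}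
    {g : E (d + 1) → E (d + 1)} (h : H10Pair (longDomain S ℓ) u g) :
    h.memLp_grad.toLp g ∈ (Submodule.span ℝ (tensorFields hS hfin ℓ)).topologicalClosure := by
  rw [← Submodule.orthogonal_orthogonal_eq_closure, Submodule.mem_orthogonal]
  intro w hw
  rw [Submodule.mem_orthogonal'] at hw
  have horth : ∀ φ χ, IsTestProfile ℓ φ → IsTestFunction S χ →
      ∫ x in longDomain S ℓ, inner ℝ (w x) (tensorGrad φ χ (gradient χ) x) = 0 := by
    intro φ χ hφ hχ
    have hm := memLp_tensorGrad hS.measurableSet hφ.1 hχ.memLp hχ.memLp_gradient ℓ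
    have h1 := hw _ (Submodule.subset_span ⟨φ, hφ, hχ.h10Pair.toH10, rfl⟩)
    have h2 : tensorMap hS hfin ℓ hφ.1 hχ.h10Pair.toH10 = hm.toLp _ :=
      MemLp.toLp_congr (memLp_tensorGrad_rep hS ℓ hφ.1 _) hm
        (tensorGrad_congr hS.measurableSet ℓ hχ.h10Pair.coeFn_toH10
          (hχ.h10Pair.gradRep_toH10 hS hfin))
    rw [h2, ← Lp.toLp_coeFn w (Lp.memLp w), inner_toLp] at h1
    exact h1
  obtain ⟨ζ, hζ, -, h2⟩ := h.exists_tendsto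
  have h3 := tendsto_integral_inner h.memLp_grad (fun k => (hζ k).memLp_gradient) (Lp.memLp w) h2
  have h4 : ∀ k, ∫ x in longDomain S ℓ, inner ℝ (gradient (ζ k) x) (w x) = 0 := fun k => by
    rw [← integral_inner_gradient_eq_zero hS.measurableSet hfin (Lp.memLp w) horth (hζ k)]
    exact integral_congr_ae (Eventually.of_forall fun x => real_inner_comm _ _)
  simp only [h4] at h3
  have h5 := tendsto_nhds_unique h3 tendsto_const_nhds
  conv_lhs => rw [← Lp.toLp_coeFn w (Lp.memLp w)]
  rw [real_inner_comm, inner_toLp h.memLp_grad (Lp.memLp w)]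
  exact h5

/-- A finite combination involves finitely many cross-section functions. Recording only these, with
arbitrary test profiles, reduces the problem to a finite-dimensional subspace of H¹₀(S). -/
lemma exists_finite_of_mem_span_tensorFields (hS : IsOpen S) (hfin : volume S ≠ ⊤)
    {y : Lp (E (d + 1)) 2 (volume.restrict (longDomain S ℓ))}
    (hy : y ∈ Submodule.span ℝ (tensorFields hS hfin ℓ)) :
    ∃ A : Set (h10Space S), A.Finite ∧
      ∀ z : Lp (E (d + 1)) 2 (volume.restrict (longDomain S ℓ)),
      (∀ φ, ∀ hφ : IsTestProfile ℓ φ, ∀ x ∈ A, inner ℝ z (tensorMap hS hfin ℓ hφ.1 x) = 0) →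
      inner ℝ z y = 0 := by
  refine Submodule.span_induction (p := fun y _ => ∃ A : Set (h10Space S), A.Finite ∧
    ∀ z : Lp (E (d + 1)) 2 (volume.restrict (longDomain S ℓ)),
    (∀ φ, ∀ hφ : IsTestProfile ℓ φ, ∀ x ∈ A, inner ℝ z (tensorMap hS hfin ℓ hφ.1 x) = 0) →
    inner ℝ z y = 0) ?_ ?_ ?_ ?_ hy
  · rintro _ ⟨φ, hφ, x, rfl⟩
    exact ⟨{x}, Set.finite_singleton x, fun z hz => hz φ hφ x rfl⟩
  · exact ⟨∅, Set.finite_empty, fun z _ => inner_zero_right _⟩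
  · rintro y1 y2 - - ⟨A1, hA1, h1⟩ ⟨A2, hA2, h2⟩
    refine ⟨A1 ∪ A2, hA1.union hA2, fun z hz => ?_⟩
    rw [inner_add_right, h1 z fun φ hφ x hx => hz φ hφ x (Or.inl hx),
      h2 z fun φ hφ x hx => hz φ hφ x (Or.inr hx), add_zero]
  · rintro c y1 - ⟨A, hA, h1⟩
    exact ⟨A, hA, fun z hz => by rw [inner_smul_right, h1 z hz, mul_zero]⟩

/-- The separated field built from an orthogonal family solves the Galerkin equations. -/
lemma inner_sub_separated_eq_zero (hS : IsOpen S) (hfin : volume S ≠ ⊤) (hℓ : 0 < ℓ)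
    {G : Lp (E (d + 1)) 2 (volume.restrict (longDomain S ℓ))} {U : h10Space S}
    (hsol : ∀ p, ∀ hp : IsProfile ℓ p, ∀ x, inner ℝ G (tensorMap hS hfin ℓ hp.contDiff x) =
      (∫ t in Set.Ioo (-ℓ) ℓ, p t) * inner ℝ (gradMap hS hfin U) (gradMap hS hfin x))
    {n : ℕ} {b : Fin n → h10Space S} {a : Fin n → ℝ} (hbo : Orthonormal ℝ b)
    (hborth : ∀ i j, i ≠ j → inner ℝ (gradMap hS hfin (b i)) (gradMap hS hfin (b j)) = 0)
    (hUsum : U = ∑ i, a i • b i) {T : Lp (E (d + 1)) 2 (volume.restrict (longDomain S ℓ))}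
    (hT : T = ∑ i, a i • tensorMap hS hfin ℓ (contDiff_psi ℓ ‖gradMap hS hfin (b i)‖) (b i))
    (p : ℝ → ℝ) (hp : IsProfile ℓ p) (h1 : p (-ℓ) = 0) (h2 : p ℓ = 0) (v : h10Space S)
    (hv : ∃ c : Fin n → ℝ, v = ∑ i, c i • b i) :
    inner ℝ (G - T) (tensorMap hS hfin ℓ hp.contDiff v) = 0 := by
  rw [hT]
  exact inner_sub_sum_eq_zero (L := gradMap hS hfin) (P := tensorMap hS hfin ℓ hp.contDiff)
    (Q := fun i => tensorMap hS hfin ℓ (contDiff_psi ℓ ‖gradMap hS hfin (b i)‖)) hbo hborth hUsum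
    (fun i x y => inner_tensorMap hS hfin ℓ (contDiff_psi ℓ _) hp.contDiff x y) (hsol p hp)
    (fun i => integral_psi_mul hℓ _ hp.contDiff h1 h2) hv

/-- The Galerkin approximation of `G` by separated solutions. -/
lemma exists_separated_approx (hS : IsOpen S) (hfin : volume S ≠ ⊤) (hℓ : 0 < ℓ)
    {G : Lp (E (d + 1)) 2 (volume.restrict (longDomain S ℓ))} {U : h10Space S}
    (hsol : ∀ p, ∀ hp : IsProfile ℓ p, ∀ x, inner ℝ G (tensorMap hS hfin ℓ hp.contDiff x) =
      (∫ t in Set.Ioo (-ℓ) ℓ, p t) * inner ℝ (gradMap hS hfin U) (gradMap hS hfin x))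
    (hG : G ∈ (Submodule.span ℝ (tensorFields hS hfin ℓ)).topologicalClosure)
    {ε : ℝ} (hε : 0 < ε) :
    ∃ (n : ℕ) (b : Fin n → h10Space S) (a : Fin n → ℝ), Orthonormal ℝ b ∧
      (∀ i j, i ≠ j → inner ℝ (gradMap hS hfin (b i)) (gradMap hS hfin (b j)) = 0) ∧
      U = ∑ i, a i • b i ∧
      ‖G - ∑ i, a i • tensorMap hS hfin ℓ (contDiff_psi ℓ ‖gradMap hS hfin (b i)‖) (b i)‖ ≤ ε := by
  obtain ⟨y, hy, hyG⟩ := Metric.mem_closure_iff.1 hG ε hε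
  obtain ⟨A, hA, hAy⟩ := exists_finite_of_mem_span_tensorFields hS hfin hy
  -- `U` is added to the finite set so that it, too, expands in `b`.
  obtain ⟨n, b, hbo, hborth, hspan⟩ := exists_orthonormal_orthogonal_map (gradMap hS hfin)
    (hA.insert U)
  obtain ⟨a, hUsum⟩ := hspan U (Set.mem_insert _ _)
  refine ⟨n, b, a, hbo, hborth, hUsum, ?_⟩
  obtain ⟨T, hT⟩ : ∃ T, T = ∑ i, a i • tensorMap hS hfin ℓ
    (contDiff_psi ℓ ‖gradMap hS hfin (b i)‖) (b i) := ⟨_, rfl⟩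
  rw [← hT]
  have hortho := inner_sub_separated_eq_zero hS hfin hℓ hsol hbo hborth hUsum hT
  have hzero : ∀ {p : ℝ → ℝ}, IsTestProfile ℓ p → p (-ℓ) = 0 ∧ p ℓ = 0 := fun hp =>
    ⟨image_eq_zero_of_notMem_tsupport fun h => lt_irrefl _ (hp.2.2 h).1,
      image_eq_zero_of_notMem_tsupport fun h => lt_irrefl _ (hp.2.2 h).2⟩
  have hy0 : inner ℝ (G - T) y = 0 := by
    refine hAy _ fun φ hφ x hx => ?_
    exact hortho φ hφ.isProfile (hzero hφ).1 (hzero hφ).2 x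
      (hspan x (Set.mem_insert_of_mem _ hx))
  -- The profiles of `T` are not compactly supported, but they lie in H¹₀(-ℓ, ℓ) and vanish at ±ℓ,
  -- so `T` is an admissible test field.
  have hT0 : inner ℝ (G - T) T = 0 := by
    refine (congrArg (inner ℝ (G - T)) hT).trans (inner_sum_smul_eq_zero fun i => ?_)
    exact hortho _ (isProfile_psi hℓ (norm_nonneg (gradMap hS hfin (b i))))
      (by simp [psi, (Real.cosh_pos _).ne'])
      (by simp [psi, (Real.cosh_pos _).ne']) (b i)
      ⟨Pi.single i 1, by simp [Pi.single_apply]⟩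
  refine norm_sub_le_of_galerkin hy0 hT0 ?_
  rw [← dist_eq_norm]
  exact hyG.le

end

/-! ### Replacing the frequencies by λ_∞, the error estimate, and decay of the bound. -/

section

section abstract
variable {H F X Y : Type*} [NormedAddCommGroup H] [InnerProductSpace ℝ H] [NormedAddCommGroup F]
  [InnerProductSpace ℝ F] [NormedAddCommGroup X] [InnerProductSpace ℝ X] [NormedAddCommGroup Y]
  [InnerProductSpace ℝ Y]

lemma map_sub_eq_add_sum {n : ℕ} {b : Fin n → H} {a : Fin n → ℝ} {P : H →ₗ[ℝ] X}
    {Q : Fin n → H →ₗ[ℝ] X} {D : Fin n → H →ₗ[ℝ] Y} {R : X →ₗ[ℝ] Y} {U : H}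
    (hU : U = ∑ i, a i • b i) (hR : ∀ i x, R (Q i x) - R (P x) = D i x) (G : X) :
    R (G - P U) = R (G - ∑ i, a i • Q i (b i)) + ∑ i, a i • D i (b i) := by
  rw [map_sub, map_sub, hU]
  simp only [← hR, smul_sub, Finset.sum_sub_distrib, map_sum, map_smul]
  abel

lemma norm_sq_sum_smul {n : ℕ} {b : Fin n → H} {a : Fin n → ℝ} {L : H →ₗ[ℝ] F}
    (hbo : Orthonormal ℝ b) (hborth : ∀ i j, i ≠ j → inner ℝ (L (b i)) (L (b j)) = 0) :
    ‖∑ i, a i • b i‖ ^ 2 = ∑ i, a i ^ 2 ∧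
      ‖L (∑ i, a i • b i)‖ ^ 2 = ∑ i, a i ^ 2 * ‖L (b i)‖ ^ 2 := by
  constructor
  · have := norm_sq_sum_eq (L := L) (a := a) (Q := fun _ => LinearMap.id) (α := fun _ _ => 1)
      (β := fun _ _ => 0) hbo hborth (by simp)
    simpa using this
  · have := norm_sq_sum_eq (L := L) (a := a) (Q := fun _ => L) (α := fun _ _ => 0)
      (β := fun _ _ => 1) hbo hborth (by simp)
    simpa using this

end abstract

/-- The scalar estimate behind the error bound. -/
lemma sum_energy_le {n : ℕ} {a m α β : Fin n → ℝ} {ℓ δ lam lamInf N M : ℝ} (hlam : 0 < lam)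
    (hδ : 0 ≤ δ) (hδℓ : δ < ℓ) (hm : ∀ i, lam ≤ m i) (hN : N = ∑ i, a i ^ 2)
    (hM : M = ∑ i, a i ^ 2 * m i ^ 2) (hNM : M = lamInf ^ 2 * N) (hlamInf : 0 ≤ lamInf)
    (hle : N = 0 ∨ lam ≤ lamInf)
    (hα : ∀ i, α i = ∫ t in Set.Ioo (-(ℓ - δ)) (ℓ - δ),
      deriv (fun t => psi ℓ (m i) t - psi ℓ lamInf t) t ^ 2)
    (hβ : ∀ i, β i = ∫ t in Set.Ioo (-(ℓ - δ)) (ℓ - δ), (psi ℓ (m i) t - psi ℓ lamInf t) ^ 2) :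
    ∑ i, a i ^ 2 * (α i + m i ^ 2 * β i) ≤ 4 / lam * Real.exp (-2 * lam * δ) * M := by
  set s := ℓ - δ with hs
  set A : ℝ → ℝ := fun r => ∫ t in Set.Ioo (-s) s, deriv (psi ℓ r) t ^ 2 with hA
  set B : ℝ → ℝ := fun r => ∫ t in Set.Ioo (-s) s, (1 - psi ℓ r t) ^ 2 with hB
  have hAB : ∀ r, 0 ≤ r → A r + r ^ 2 * B r ≤ 2 * r * Real.exp (-2 * r * δ) :=
    fun r hr => integral_cosh_energy_le hr hδℓ
  -- Since r ≤ r²/λ₁, the first power of r becomes r², which sums to the energy `M`; the exponential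
  -- decreases in r because δ ≥ 0.
  have hexp : ∀ r, lam ≤ r → 2 * r * Real.exp (-2 * r * δ) ≤
      2 / lam * Real.exp (-2 * lam * δ) * r ^ 2 := by
    intro r hr
    have h1 : Real.exp (-2 * r * δ) ≤ Real.exp (-2 * lam * δ) :=
      Real.exp_le_exp.2 (by nlinarith)
    have h2 : r ≤ r ^ 2 / lam := by rw [le_div_iff₀ hlam]; nlinarith
    have h0 := Real.exp_pos (-2 * lam * δ)
    calc 2 * r * Real.exp (-2 * r * δ) ≤ 2 * (r ^ 2 / lam) * Real.exp (-2 * lam * δ) := by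
          have : 0 ≤ r := hlam.le.trans hr
          gcongr
      _ = _ := by ring
  have hterm : ∀ i, a i ^ 2 * (α i + m i ^ 2 * β i) ≤
      2 / lam * Real.exp (-2 * lam * δ) * (a i ^ 2 * m i ^ 2) +
        (A lamInf * a i ^ 2 + B lamInf * (a i ^ 2 * m i ^ 2)) := by
    intro i
    have hmi : 0 ≤ m i := hlam.le.trans (hm i)
    obtain ⟨h1, h2⟩ := integral_sq_psi_sub_le (ℓ := ℓ) hmi hlamInf s
    rw [← hα i] at h1
    rw [← hβ i] at h2
    have h3 := (hAB (m i) hmi).trans (hexp _ (hm i))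
    have h4 : α i + m i ^ 2 * β i ≤ 2 / lam * Real.exp (-2 * lam * δ) * m i ^ 2 +
        (A lamInf + m i ^ 2 * B lamInf) := by
      have h5 := mul_le_mul_of_nonneg_left h2 (sq_nonneg (m i))
      simp only [hA, hB] at h3 ⊢
      linarith
    have h6 := mul_le_mul_of_nonneg_left h4 (sq_nonneg (a i))
    linarith
  refine (Finset.sum_le_sum fun i _ => hterm i).trans ?_
  rw [Finset.sum_add_distrib, Finset.sum_add_distrib, ← Finset.mul_sum, ← Finset.mul_sum,
    ← Finset.mul_sum, ← hM, ← hN]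
  -- The choice of λ_∞ enters here: M = λ_∞² N turns the left side into N times the cosh energy at
  -- frequency λ_∞.
  have hlast : A lamInf * N + B lamInf * M ≤ 2 / lam * Real.exp (-2 * lam * δ) * M := by
    rcases hle with h0 | hle
    · simp [hNM, h0]
    · have hN0 : 0 ≤ N := hN ▸ Finset.sum_nonneg fun i _ => sq_nonneg _
      have h1 := mul_le_mul_of_nonneg_right ((hAB lamInf hlamInf).trans (hexp _ hle)) hN0
      rw [hNM]
      linarith
  have : 4 / lam * Real.exp (-2 * lam * δ) * M = 2 / lam * Real.exp (-2 * lam * δ) * M +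
    2 / lam * Real.exp (-2 * lam * δ) * M := by ring
  linarith

variable {d : ℕ} {S : Set (E d)} {ℓ δ : ℝ}

lemma H10Pair.tensorMap_toH10 (hS : IsOpen S) (hfin : volume S ≠ ⊤) (s : ℝ) {p : ℝ → ℝ}
    (hp : ContDiff ℝ ((⊤ : ℕ∞) : WithTop ℕ∞) p) {u : E d → ℝ} {g : E d → E d}
    (h : H10Pair S u g) : tensorMap hS hfin s hp h.toH10 =
      (memLp_tensorGrad hS.measurableSet hp h.memLp h.memLp_grad s).toLp (tensorGrad p u g) :=
  MemLp.toLp_congr (memLp_tensorGrad_rep hS s hp _) _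
    (tensorGrad_congr hS.measurableSet s h.coeFn_toH10 (h.gradRep_toH10 hS hfin))

lemma H10Pair.norm_toH10 {u : E d → ℝ} {g : E d → E d} (h : H10Pair S u g) :
    ‖h.toH10‖ = l2norm S u := by
  rw [l2norm_eq_toReal h.memLp, ← Lp.norm_toLp u h.memLp]
  rfl

lemma H10Pair.gradMap_toH10 (hS : IsOpen S) (hfin : volume S ≠ ⊤) {u : E d → ℝ} {g : E d → E d}
    (h : H10Pair S u g) : gradMap hS hfin h.toH10 = h.memLp_grad.toLp g :=
  MemLp.toLp_congr (h10Pair_gradRep _).memLp_grad _ (h.gradRep_toH10 hS hfin)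

lemma H10Pair.norm_gradMap_toH10 (hS : IsOpen S) (hfin : volume S ≠ ⊤) {u : E d → ℝ}
    {g : E d → E d} (h : H10Pair S u g) : ‖gradMap hS hfin h.toH10‖ = l2norm S g := by
  rw [h.gradMap_toH10, Lp.norm_toLp, l2norm_eq_toReal h.memLp_grad]

lemma norm_h10Space_eq (x : h10Space S) :
    ‖x‖ = l2norm S (x : Lp ℝ 2 (volume.restrict S)) := by
  rw [l2norm_eq_toReal (h10Pair_gradRep x).memLp, ← Submodule.norm_coe, Lp.norm_def]

lemma norm_gradMap_eq (hS : IsOpen S) (hfin : volume S ≠ ⊤) (x : h10Space S) :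
    ‖gradMap hS hfin x‖ = l2norm S (gradRep x) := by
  rw [l2norm_eq_toReal (h10Pair_gradRep x).memLp_grad]
  exact Lp.norm_toLp _ (h10Pair_gradRep x).memLp_grad

lemma lambdaOne_mul_norm_le (hS : IsOpen S) (hfin : volume S ≠ ⊤) (x : h10Space S) :
    lambdaOne S * ‖x‖ ≤ ‖gradMap hS hfin x‖ := by
  rw [norm_h10Space_eq, norm_gradMap_eq]
  exact lambdaOne_mul_le hS hfin (h10Pair_gradRep x)

/-- Testing the equation of u_ℓ with p ⊗ x gives (∫ p)(∫ f x), and the equation of u_∞ tested with x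
rewrites ∫ f x. Thus `f` disappears and only `U` remains. -/
lemma IsWeakSolution.inner_tensorMap (hS : IsOpen S) (hfin : volume S ≠ ⊤) {f uinf : E d → ℝ}
    (hu : IsWeakSolution S f uinf) {ul : E (d + 1) → ℝ}
    (hul : IsWeakSolution (longDomain S ℓ) (tensor (fun _ => 1) f) ul) (p : ℝ → ℝ)
    (hp : IsProfile ℓ p) (x : h10Space S) :
    inner ℝ ((hul.1.h10Pair (isOpen_longDomain hS ℓ)).memLp_grad.toLp _)
        (tensorMap hS hfin ℓ hp.contDiff x) =
      (∫ t in Set.Ioo (-ℓ) ℓ, p t) *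
        inner ℝ (gradMap hS hfin (hu.1.h10Pair hS).toH10) (gradMap hS hfin x) := by
  have hΩ := isOpen_longDomain hS ℓ
  have hΩfin := volume_longDomain_ne_top hS.measurableSet hfin ℓ
  have hx := h10Pair_gradRep x
  have hv := hx.tensor hS.measurableSet hp
  have e1 : inner ℝ ((hul.1.h10Pair hΩ).memLp_grad.toLp _) (tensorMap hS hfin ℓ hp.contDiff x) =
      ∫ z in longDomain S ℓ, inner ℝ (weakGrad (longDomain S ℓ) ul z)
        (tensorGrad p x (gradRep x) z) :=
    inner_toLp (hul.1.h10Pair hΩ).memLp_grad (memLp_tensorGrad_rep hS ℓ hp.contDiff x)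
  have e2 : ∫ z in longDomain S ℓ, inner ℝ (weakGrad (longDomain S ℓ) ul z)
        (tensorGrad p x (gradRep x) z) =
      ∫ z in longDomain S ℓ, tensor (fun _ => 1) f z * tensor p x z := by
    rw [← hul.2 _ (hv.memH10 hΩ hΩfin)]
    refine integral_congr_ae ?_
    filter_upwards [(hv.h1Pair hΩfin).weakGrad_ae_eq hΩ] with z hz
    rw [hz]
  have e3 : ∫ z in longDomain S ℓ, tensor (fun _ => 1) f z * tensor p x z =
      (∫ t in Set.Ioo (-ℓ) ℓ, p t) *
        ∫ y in S, f y * (x : Lp ℝ 2 (volume.restrict S)) y := by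
    rw [← setIntegral_longDomain_mul hS.measurableSet ℓ p
      (fun y => f y * (x : Lp ℝ 2 (volume.restrict S)) y)]
    refine integral_congr_ae (Eventually.of_forall fun z => ?_)
    simp only [tensor]; ring
  have e4 : ∫ y in S, f y * (x : Lp ℝ 2 (volume.restrict S)) y =
      ∫ y in S, inner ℝ (weakGrad S uinf y) (gradRep x y) := by
    rw [← hu.2 _ (hx.memH10 hS hfin)]
    refine integral_congr_ae ?_
    filter_upwards [(hx.h1Pair hfin).weakGrad_ae_eq hS] with z hz
    rw [hz]
  have e5 : inner ℝ (gradMap hS hfin (hu.1.h10Pair hS).toH10) (gradMap hS hfin x) =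
      ∫ y in S, inner ℝ (weakGrad S uinf y) (gradRep x y) := by
    rw [H10Pair.gradMap_toH10]
    exact inner_toLp _ hx.memLp_grad
  rw [e1, e2, e3, e4, e5]

lemma longDomain_mono (S : Set (E d)) {s t : ℝ} (h : s ≤ t) : longDomain S s ⊆ longDomain S t :=
  fun _ hx => ⟨⟨by linarith [hx.1.1], by linarith [hx.1.2]⟩, hx.2⟩

lemma lambdaInf_nonneg (S : Set (E d)) (u : E d → ℝ) : 0 ≤ lambdaInf S u :=
  div_nonneg (l2norm_nonneg _ _) (l2norm_nonneg _ _)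

lemma h1Pair_approxError (hS : IsOpen S) (hfin : volume S ≠ ⊤) (hℓ : 0 < ℓ) {uinf : E d → ℝ}
    (hu : MemH10 S uinf) {ul : E (d + 1) → ℝ} (hul : MemH10 (longDomain S ℓ) ul) :
    H1Pair (longDomain S ℓ) (approxError S uinf ℓ ul)
      (weakGrad (longDomain S ℓ) ul -
        tensorGrad (psi ℓ (lambdaInf S uinf)) uinf (weakGrad S uinf)) := by
  have hΩfin := volume_longDomain_ne_top hS.measurableSet hfin ℓ
  exact ((hul.h10Pair (isOpen_longDomain hS ℓ)).h1Pair hΩfin).sub hΩfin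
    (((hu.h10Pair hS).tensor hS.measurableSet
      (isProfile_psi hℓ (lambdaInf_nonneg S uinf))).h1Pair hΩfin)

/-- On the shorter cylinder the error is a Galerkin remainder of norm at most ε plus a finite sum
whose energy `sum_energy_le` controls. That control does not depend on the Galerkin space, so ε can
tend to 0. -/
lemma sq_l2norm_weakGrad_approxError_le (hS : IsOpen S) (hfin : volume S ≠ ⊤)
    (hpos : 0 < lambdaOne S) {f uinf : E d → ℝ}
    (hu : IsWeakSolution S f uinf) (hδ : 0 ≤ δ) (hδℓ : δ < ℓ) {ul : E (d + 1) → ℝ}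
    (hul : IsWeakSolution (longDomain S ℓ) (tensor (fun _ => 1) f) ul) :
    l2norm (longDomain S (ℓ - δ))
        (weakGrad (longDomain S ℓ) (approxError S uinf ℓ ul)) ^ 2 ≤
      4 / lambdaOne S * Real.exp (-2 * lambdaOne S * δ) * l2norm S (weakGrad S uinf) ^ 2 := by
  have hℓ : 0 < ℓ := hδ.trans_lt hδℓ
  have hup := hu.1.h10Pair hS
  have hulp := hul.1.h10Pair (isOpen_longDomain hS ℓ)
  have hle : volume.restrict (longDomain S (ℓ - δ)) ≤ volume.restrict (longDomain S ℓ) :=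
    Measure.restrict_mono (longDomain_mono S (by linarith)) le_rfl
  have hpsi := contDiff_psi ℓ (lambdaInf S uinf)
  have hpair := h1Pair_approxError hS hfin hℓ hu.1 hul.1
  have hae := hpair.weakGrad_ae_eq (isOpen_longDomain hS ℓ)
  have hm := memLp_tensorGrad hS.measurableSet hpsi hup.memLp hup.memLp_grad ℓ
  have hnorm : l2norm (longDomain S (ℓ - δ))
      (weakGrad (longDomain S ℓ) (approxError S uinf ℓ ul)) =
      ‖restrictLp hle (hulp.memLp_grad.toLp _ - tensorMap hS hfin ℓ hpsi hup.toH10)‖ := by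
    rw [hup.tensorMap_toH10, ← MemLp.toLp_sub, restrictLp_toLp, Lp.norm_toLp,
      ← l2norm_eq_toReal (hpair.memLp_grad.mono_measure hle)]
    exact l2norm_congr (hle.absolutelyContinuous.ae_le hae)
  have hlamInf := lambdaInf_nonneg S uinf
  set K := 4 / lambdaOne S * Real.exp (-2 * lambdaOne S * δ) * l2norm S (weakGrad S uinf) ^ 2
    with hK
  have hK0 : 0 ≤ K := by positivity
  have hmain : ∀ ε > 0, l2norm (longDomain S (ℓ - δ))
      (weakGrad (longDomain S ℓ) (approxError S uinf ℓ ul)) ≤ Real.sqrt K + ε := by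
    intro ε hε
    obtain ⟨n, b, a, hbo, hborth, hU, hG⟩ := exists_separated_approx hS hfin hℓ
      (hu.inner_tensorMap hS hfin hul) (mem_closure_tensorFields hS hfin hulp) hε
    have hsplit := map_sub_eq_add_sum (R := restrictLp hle) (P := tensorMap hS hfin ℓ hpsi)
      (Q := fun i => tensorMap hS hfin ℓ (contDiff_psi ℓ ‖gradMap hS hfin (b i)‖))
      (D := fun i => tensorMap hS hfin (ℓ - δ)
        ((contDiff_psi ℓ ‖gradMap hS hfin (b i)‖).sub hpsi)) hU
      (fun i x => by
        rw [restrictLp_tensorMap, restrictLp_tensorMap]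
        exact tensorMap_sub hS hfin (ℓ - δ) _ hpsi x)
      (hulp.memLp_grad.toLp _)
    have hsq := norm_sq_sum_eq (a := a) (L := gradMap hS hfin)
      (Q := fun i => tensorMap hS hfin (ℓ - δ)
        ((contDiff_psi ℓ ‖gradMap hS hfin (b i)‖).sub hpsi)) hbo hborth
      (fun i j x y => inner_tensorMap hS hfin (ℓ - δ) _ _ x y)
    obtain ⟨hN, hM⟩ := norm_sq_sum_smul (a := a) (L := gradMap hS hfin) hbo hborth
    rw [← hU] at hN hM
    rw [hup.norm_toH10] at hN
    rw [hup.norm_gradMap_toH10] at hM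
    have hbound := sum_energy_le (a := a) (m := fun i => ‖gradMap hS hfin (b i)‖)
      (lamInf := lambdaInf S uinf) hpos hδ hδℓ
      (fun i => by simpa [hbo.1 i] using lambdaOne_mul_norm_le hS hfin (b i)) hN hM
      -- If u_∞ = 0 almost everywhere, its gradient vanishes by linearity of `gradMap`, and the
      -- relation holds whatever λ_∞ is.
      (by
        rcases eq_or_ne (l2norm S uinf) 0 with h0 | h0
        · have : hup.toH10 = 0 := by rw [← norm_eq_zero, hup.norm_toH10, h0]
          rw [← hup.norm_gradMap_toH10 hS hfin, this, h0]; simp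
        · rw [lambdaInf, div_pow, div_mul_cancel₀ _ (pow_ne_zero 2 h0)]) hlamInf
      (by
        rcases eq_or_ne (l2norm S uinf) 0 with h0 | h0
        · left; rw [h0]; simp
        · right
          rw [lambdaInf, le_div_iff₀ (lt_of_le_of_ne (l2norm_nonneg _ _) h0.symm)]
          exact lambdaOne_mul_le hS hfin hup)
      (fun i => rfl) (fun i => rfl)
    rw [hnorm, hsplit]
    refine (norm_add_le _ _).trans ?_
    rw [add_comm]
    refine add_le_add ?_ ((norm_restrictLp_le hle _).trans hG)
    refine Real.le_sqrt_of_sq_le ?_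
    rw [hsq, hK]
    simpa only [sq] using hbound
  have h := le_of_forall_pos_le_add hmain
  calc _ ≤ Real.sqrt K ^ 2 := by gcongr; exact l2norm_nonneg _ _
    _ = K := Real.sq_sqrt hK0

/-- The left side is the first term of C⁽²⁾; the C⁽¹⁾ term and the rest of C⁽²⁾ are nonnegative. -/
lemma le_errorBound (uinf : E d → ℝ) (hδℓ : δ ≤ ℓ) :
    4 / lambdaOne S * Real.exp (-2 * lambdaOne S * δ) * l2norm S (weakGrad S uinf) ^ 2 ≤
      errorBound S uinf ℓ δ := by
  have h1 : 0 ≤ C1 S δ * l2norm S uinf ^ 2 := by unfold C1; positivity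
  have h2 : 4 / lambdaOne S * Real.exp (-2 * lambdaOne S * δ) ≤ C2 S ℓ δ := by
    have : 0 ≤ 6 * (ℓ - δ) * Real.exp (-2 * lambdaOne S * ℓ) := by
      have : 0 ≤ ℓ - δ := by linarith
      positivity
    have e : 4 / lambdaOne S * Real.exp (-2 * lambdaOne S * δ) =
      4 * (1 / lambdaOne S * Real.exp (-2 * lambdaOne S * δ)) := by ring
    rw [e, C2]
    linarith
  have h3 := mul_le_mul_of_nonneg_right h2 (sq_nonneg (l2norm S (weakGrad S uinf)))
  unfold errorBound
  linarith

lemma errorBound_nonneg (hpos : 0 < lambdaOne S) (uinf : E d → ℝ) (hδℓ : δ ≤ ℓ) :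
    0 ≤ errorBound S uinf ℓ δ :=
  le_trans (by positivity) (le_errorBound uinf hδℓ)

lemma errorBound_le (hpos : 0 < lambdaOne S) (uinf : E d → ℝ) (ℓ δ : ℝ) :
    errorBound S uinf ℓ δ ≤ (4 + 16 / lambdaOne S) * Real.exp (-(2 * lambdaOne S) * δ) *
      (l2norm S uinf ^ 2 + l2norm S (weakGrad S uinf) ^ 2) := by
  set lam := lambdaOne S with hlam
  have hexp : -2 * lam * δ = -(2 * lam) * δ := by ring
  -- With x = ℓ - δ this is x e^{-2λ₁x} ≤ 1/(2λ₁), which follows from y + 1 ≤ e^y at y = 2λ₁x. It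
  -- removes the growing factor ℓ - δ uniformly in ℓ.
  have h1 : (ℓ - δ) * Real.exp (-2 * lam * ℓ) ≤ 1 / (2 * lam) * Real.exp (-(2 * lam) * δ) := by
    have e : Real.exp (-2 * lam * ℓ) =
        Real.exp (-(2 * lam * (ℓ - δ))) * Real.exp (-(2 * lam) * δ) := by
      rw [← Real.exp_add]; congr 1; ring
    rw [e, ← mul_assoc]
    gcongr
    rw [le_div_iff₀ (by positivity)]
    have h2 := Real.add_one_le_exp (2 * lam * (ℓ - δ))
    have h3 : Real.exp (-(2 * lam * (ℓ - δ))) * Real.exp (2 * lam * (ℓ - δ)) = 1 := by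
      rw [← Real.exp_add]; simp
    have h4 := Real.exp_pos (-(2 * lam * (ℓ - δ)))
    nlinarith
  -- The constant is 4 (1/λ₁ + 6/(2λ₁)) = 16/λ₁.
  have h2 : C2 S ℓ δ ≤ 16 / lam * Real.exp (-(2 * lam) * δ) := by
    have e : 16 / lam * Real.exp (-(2 * lam) * δ) =
        4 * (1 / lam * Real.exp (-(2 * lam) * δ) +
          6 * (1 / (2 * lam) * Real.exp (-(2 * lam) * δ))) := by
      field_simp; ring
    rw [e, C2, ← hlam, hexp]
    have := h1
    nlinarith
  have h3 : C1 S δ = 4 * Real.exp (-(2 * lam) * δ) := by rw [C1, ← hlam, hexp]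
  have hE := Real.exp_pos (-(2 * lam) * δ)
  have h4 := mul_le_mul_of_nonneg_right h2 (sq_nonneg (l2norm S (weakGrad S uinf)))
  have h5 : 0 ≤ 16 / lam * Real.exp (-(2 * lam) * δ) * l2norm S uinf ^ 2 := by positivity
  have h6 : 0 ≤ 4 * Real.exp (-(2 * lam) * δ) * l2norm S (weakGrad S uinf) ^ 2 := by positivity
  rw [errorBound, h3]
  linarith

lemma errorBound_isBigO (hpos : 0 < lambdaOne S) (uinf : E d → ℝ) {ε : ℝ} (hε : 0 < ε)
    {δ : ℝ → ℝ} (hδ : ∀ᶠ ℓ in atTop, ε * ℓ ≤ δ ℓ ∧ δ ℓ < ℓ) :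
    (fun ℓ : ℝ => errorBound S uinf ℓ (δ ℓ)) =O[atTop]
        (fun ℓ : ℝ => Real.exp (-(2 * lambdaOne S) * ε * ℓ)) ∧
      Tendsto (fun ℓ : ℝ => errorBound S uinf ℓ (δ ℓ)) atTop (𝓝 0) := by
  have hO : (fun ℓ : ℝ => errorBound S uinf ℓ (δ ℓ)) =O[atTop]
      (fun ℓ : ℝ => Real.exp (-(2 * lambdaOne S) * ε * ℓ)) := by
    refine IsBigO.of_bound ((4 + 16 / lambdaOne S) *
      (l2norm S uinf ^ 2 + l2norm S (weakGrad S uinf) ^ 2)) ?_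
    filter_upwards [hδ] with ℓ ⟨h1, h2⟩
    rw [Real.norm_of_nonneg (errorBound_nonneg hpos uinf h2.le),
      Real.norm_of_nonneg (Real.exp_pos _).le]
    refine (errorBound_le hpos uinf ℓ (δ ℓ)).trans ?_
    rw [mul_right_comm]
    refine mul_le_mul_of_nonneg_left (Real.exp_le_exp.2 ?_) (by positivity)
    nlinarith
  -- The comparison function tends to 0 because 2λ₁ε > 0.
  refine ⟨hO, hO.trans_tendsto ?_⟩
  refine Real.tendsto_exp_atBot.comp ?_
  exact tendsto_id.const_mul_atTop_of_neg (by nlinarith)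

end

end LongDomain

open LongDomain
theorem lemma1 (d : ℕ) (hd : 1 ≤ d) (S : Set (E d))
    (hS_open : IsOpen S) (hS_bdd : Bornology.IsBounded S) (hS_ne : S.Nonempty) :
    0 < lambdaOne S ∧
    ∃ c > (0 : ℝ), ∃ c' > (0 : ℝ),
      ∀ f : E d → ℝ, MemLp f 2 (volume.restrict S) →
      ∀ uinf : E d → ℝ, IsWeakSolution S f uinf →
        -- the error estimate
        (∀ ℓ δ : ℝ, 0 ≤ δ → δ < ℓ → ∀ ul : E (d + 1) → ℝ,
          IsWeakSolution (longDomain S ℓ)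
            (tensor (fun _ => 1) f) ul →
          MemH1 (longDomain S ℓ) (approxError S uinf ℓ ul) ∧
          l2norm (longDomain S (ℓ - δ))
              (weakGrad (longDomain S ℓ)
                (approxError S uinf ℓ ul)) ^ 2
            ≤ errorBound S uinf ℓ δ) ∧
        -- the bound decays exponentially in `δ`, uniformly in `ℓ`
        (∀ ℓ δ : ℝ, 0 ≤ δ → δ < ℓ →
          errorBound S uinf ℓ δ ≤ c * Real.exp (-c' * δ) *
            (l2norm S uinf ^ 2 +
              l2norm S (weakGrad S uinf) ^ 2)) ∧
        -- hence exponentially in `ℓ` if `δ_ℓ` is bounded below by a positive multiple of `ℓ`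
        (∀ ε > (0 : ℝ), ∀ δ : ℝ → ℝ, (∀ᶠ ℓ in atTop, ε * ℓ ≤ δ ℓ ∧ δ ℓ < ℓ) →
          (fun ℓ : ℝ => errorBound S uinf ℓ (δ ℓ)) =O[atTop]
            (fun ℓ : ℝ => Real.exp (-c' * ε * ℓ)) ∧
          Tendsto (fun ℓ : ℝ => errorBound S uinf ℓ (δ ℓ)) atTop (𝓝 0)) := by
  have hpos := lambdaOne_pos hd hS_open hS_bdd hS_ne
  have hfin : volume S ≠ ⊤ := hS_bdd.measure_lt_top.ne
  -- The prefactor adds the constants 4 of C⁽¹⁾ and 16/λ₁ bounding C⁽²⁾; the rate is 2λ₁. Both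
  -- depend on the cross-section only.
  refine ⟨hpos, 4 + 16 / lambdaOne S, by positivity, 2 * lambdaOne S, by positivity,
    fun f _ uinf hu => ⟨fun ℓ δ hδ hδℓ ul hul => ⟨?_, ?_⟩, fun ℓ δ _ _ => ?_,
      fun ε hε δ hδ => errorBound_isBigO hpos uinf hε hδ⟩⟩
  · exact (h1Pair_approxError hS_open hfin (hδ.trans_lt hδℓ) hu.1 hul.1).memH1
  · exact (sq_l2norm_weakGrad_approxError_le hS_open hfin hpos hu hδ hδℓ hul).trans
      (le_errorBound uinf hδℓ.le)
  · exact errorBound_le hpos uinf ℓ δ
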